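/- **Theorem.** Let $\mathcal E$ be a category with finite limits. A *polynomial* in $\mathcal E$ is an exponentiable morphism $p\colon P_*\to P$, i.e. one for which the pullback functor $\mathcal E/P\to\mathcal E/P_*$ has a right adjoint $\Pi_p$. A morphism of polynomials $\varphi\colon p\to q$ consists of $\varphi_1\colon P\to Q$ and $\varphi^\sharp\colon P\times_Q Q_*\to P_*$ over $P$ (up to the choice of the pullback), and $\psi\circ\varphi$ is given by $\psi_1\circ\varphi_1$ together with $(x,d)\mapsto\varphi^\sharp(x,\psi^\sharp(\varphi_1x,d))$. Polynomials form a monoidal category under the composition product $$p\triangleleft q\colon\ \bigl(\Pi_p(Q\times P_*)\times_P P_*\bigr)\times_Q Q_*\to \Pi_p(Q\times P_*)\times_P P_*\to\Pi_p(Q\times P_*),$$ whose unit $y$ is the identity of the terminal object $1$. Let $c\colon C_*\to C$ be a polynomial in $\mathcal E$. There is a bijection between * $\triangleleft$-comonoid structures on $c$, i.e. pairs of morphisms of polynomials $\varepsilon\colon c\to y$ and $\delta\colon c\to c\triangleleft c$ satisfying the counit and coassociativity laws, and * internal categories in $\mathcal E$ with source map $c$, i.e. triples of morphisms $t\colon C_*\to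 C$, $i\colon C\to C_*$ and $k\colon C_*\times_{t,c}C_*\to C_*$ with $c\circ i=\mathrm{id}=t\circ i$, $c\circ k=c\circ\pi_1$, $t\circ k=t\circ\pi_2$, satisfying the left and right unit laws and the associativity law. Under this bijection, $(\varepsilon,\delta)$ corresponds to the $(t,i,k)$ such that $i=\varepsilon^\sharp\colon C\cong C\times_1 1\to C_*$; the morphism $\delta_1\colon C\to\Pi_c(C\times C_*)$ is the transpose of $(t,\mathrm{id})\colon C_*\to C\times C_*$ over $C_*$; and $\delta^\sharp$ is the composite of $k$ with the morphism from $C\times_{\Pi_c(C\times C_*)}\bigl((\Pi_c(C\times C_*)\times_C C_*)\times_C C_*\bigr)$ to $C_*\times_{t,c}C_*$ given by the two projections to $C_*$. -/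

import Mathlib

open CategoryTheory CategoryTheory.Limits

universe v u

namespace PolyIn

attribute [local simp] pullback.lift_fst pullback.lift_snd pullback.lift_fst_assoc
  pullback.lift_snd_assoc

variable {E : Type u} [Category.{v} E] [HasFiniteLimits E]

/-- For `y = g ≫ x`, the morphism `Y ×_A B ⟶ X ×_A B` induced by `g : Y ⟶ X`. -/
noncomputable def bc {X Y A B : E} (g : Y ⟶ X) (x : X ⟶ A) (y : Y ⟶ A) (f : B ⟶ A)
    (h : g ≫ x = y) : pullback y f ⟶ pullback x f :=
  pullback.lift (pullback.fst y f ≫ g) (pullback.snd y f)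
    (by rw [Category.assoc, h, pullback.condition])

@[simp] theorem bc_snd {X Y A B : E} (g : Y ⟶ X) (x : X ⟶ A) (y : Y ⟶ A) (f : B ⟶ A)
    (h : g ≫ x = y) : bc g x y f h ≫ pullback.snd x f = pullback.snd y f :=
  pullback.lift_snd ..

@[simp] theorem lift_bc {W X Y A B : E} (g : Y ⟶ X) (x : X ⟶ A) (y : Y ⟶ A) (f : B ⟶ A)
    (h : g ≫ x = y) (w : W ⟶ Y) (b : W ⟶ B) (hb : w ≫ y = b ≫ f) :
    pullback.lift w b hb ≫ bc g x y f h =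
      pullback.lift (w ≫ g) b (by rw [Category.assoc, h, hb]) := by
  apply pullback.hom_ext <;> simp [bc]

@[simp] theorem lift_bc_assoc {W X Y A B Z : E} (g : Y ⟶ X) (x : X ⟶ A) (y : Y ⟶ A) (f : B ⟶ A)
    (h : g ≫ x = y) (w : W ⟶ Y) (b : W ⟶ B) (hb : w ≫ y = b ≫ f) (k : pullback x f ⟶ Z) :
    pullback.lift w b hb ≫ bc g x y f h ≫ k =
      pullback.lift (w ≫ g) b (by rw [Category.assoc, h, hb]) ≫ k := by
  rw [← Category.assoc, lift_bc]

theorem bc_bc {X Y Z A B : E} (g : Y ⟶ X) (k : Z ⟶ Y) (x : X ⟶ A) (y : Y ⟶ A) (z : Z ⟶ A)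
    (f : B ⟶ A) (h : g ≫ x = y) (h' : k ≫ y = z) :
    bc (k ≫ g) x z f (by rw [Category.assoc, h, h']) = bc k y z f h' ≫ bc g x y f h := by
  apply pullback.hom_ext <;> simp [bc]

/-- An elementwise form of exponentiability: for every `h : C ⟶ B` there is a distributivity
pullback around `(f, h)`, i.e. an object `P` over `A` with an evaluation map
`P ×_A B ⟶ C` over `B` which is terminal among such. -/
def HasDistributivityPullbacks {A B : E} (f : B ⟶ A) : Prop :=
  ∀ (C : E) (h : C ⟶ B), ∃ (P : E) (π : P ⟶ A) (ev : pullback π f ⟶ C),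
    ev ≫ h = pullback.snd π f ∧ ∀ (X : E) (x : X ⟶ A) (m : pullback x f ⟶ C),
      m ≫ h = pullback.snd x f → ∃! n : X ⟶ P, ∃ hn : n ≫ π = x, bc n π x f hn ≫ ev = m

theorem hasDistributivityPullbacks_of_isLeftAdjoint {A B : E} (f : B ⟶ A)
    [(Over.pullback f).IsLeftAdjoint] : HasDistributivityPullbacks f := by
  intro C h
  let adj := Adjunction.ofIsLeftAdjoint (Over.pullback f)
  let R := (Over.pullback f).rightAdjoint
  refine ⟨(R.obj (Over.mk h)).left, (R.obj (Over.mk h)).hom, (adj.counit.app (Over.mk h)).left,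
    Over.w (adj.counit.app (Over.mk h)), fun X x m hm => ?_⟩
  let M : (Over.pullback f).obj (Over.mk x) ⟶ Over.mk h := Over.homMk m hm
  refine ⟨(adj.homEquiv _ _ M).left, ⟨Over.w (adj.homEquiv _ _ M), ?_⟩, ?_⟩
  · have := congrArg (fun k => k.left) ((adj.homEquiv _ _).symm_apply_apply M)
    rw [adj.homEquiv_counit] at this
    exact this
  · rintro n ⟨hn, h2⟩
    let N : Over.mk x ⟶ R.obj (Over.mk h) := Over.homMk n hn
    have : M = (adj.homEquiv _ _).symm N := by
      rw [adj.homEquiv_counit]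
      ext
      exact h2.symm
    change N.left = _
    rw [this, Equiv.apply_symm_apply]

theorem isLeftAdjoint_of_hasDistributivityPullbacks {A B : E} (f : B ⟶ A)
    (H : HasDistributivityPullbacks f) : (Over.pullback f).IsLeftAdjoint := by
  choose P π ev hev hu using H
  choose n hn hn' using hu
  choose hn0 hn1 using hn
  refine ⟨_, ⟨Adjunction.adjunctionOfEquivRight (F := Over.pullback f)
    (G_obj := fun Y => Over.mk (π Y.left Y.hom))
    (fun X Y =>
    { toFun := fun k => Over.homMk (n Y.left Y.hom X.left X.hom k.left (Over.w k)) (hn0 ..)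
      invFun := fun l => Over.homMk (bc l.left _ _ f (Over.w l) ≫ ev Y.left Y.hom) (by
        have := hev Y.left Y.hom
        change (bc l.left _ _ f (Over.w l) ≫ ev Y.left Y.hom) ≫ Y.hom = pullback.snd X.hom f
        rw [Category.assoc, this]
        exact pullback.lift_snd ..)
      left_inv := fun k => by
        ext
        exact hn1 ..
      right_inv := fun l => by
        ext
        exact (hn' _ _ _ _ _ _ l.left ⟨Over.w l, rfl⟩).symm }) ?_⟩⟩
  intro X' X Y g k
  have e0 := hn0 _ _ _ _ k.left (Over.w k)
  ext
  refine (hn' _ _ _ _ _ _ _ ⟨?_, ?_⟩).symm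
  · exact (Category.assoc g.left _ _).trans ((congrArg (g.left ≫ ·) e0).trans (Over.w g))
  · change bc (g.left ≫ _) _ X'.hom f _ ≫ _ = bc g.left X.hom X'.hom f (Over.w g) ≫ k.left
    refine Eq.trans ?_ (congrArg (bc g.left X.hom X'.hom f (Over.w g) ≫ ·)
      (hn1 _ _ _ _ k.left (Over.w k)))
    refine Eq.trans ?_ (Category.assoc ..)
    exact congrArg (· ≫ _) (bc_bc _ g.left _ X.hom _ _ e0 (Over.w g))

theorem HasDistributivityPullbacks.baseChange {A B A' : E} {f : B ⟶ A}
    (H : HasDistributivityPullbacks f) (g : A' ⟶ A) :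
    HasDistributivityPullbacks (pullback.fst g f) := by
  intro C h
  obtain ⟨P, π, ev, hev, hu⟩ := H C (h ≫ pullback.snd g f)
  obtain ⟨Q, ρ, ew, hew, hv⟩ := H (pullback g f) (pullback.snd g f)
  obtain ⟨a, ⟨ha, ha'⟩, -⟩ := hv P π (ev ≫ h) (by rw [Category.assoc, hev])
  obtain ⟨η, ⟨hη, hη'⟩, -⟩ := hv A' g (𝟙 _) (by simp)
  have c1 : (pullback.fst (pullback.fst η a) (pullback.fst g f) ≫ pullback.snd η a) ≫ π =
      (pullback.snd (pullback.fst η a) (pullback.fst g f) ≫ pullback.snd g f) ≫ f := by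
    rw [← ha, Category.assoc, Category.assoc, ← pullback.condition_assoc, hη,
      pullback.condition_assoc, pullback.condition]
  refine ⟨pullback η a, pullback.fst η a, pullback.lift _ _ c1 ≫ ev, ?_, ?_⟩
  · have e1 : pullback.lift _ _ c1 ≫ bc a ρ π f ha =
        pullback.lift (pullback.fst _ _ ≫ pullback.fst η a) (pullback.snd _ _ ≫ pullback.snd g f)
          (by rw [Category.assoc, Category.assoc, pullback.condition_assoc, pullback.condition]) ≫ bc η ρ g f hη := by
      rw [lift_bc, lift_bc]
      congr 1
      rw [Category.assoc, Category.assoc, ← pullback.condition]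
    rw [Category.assoc, ← ha', ← Category.assoc, e1, Category.assoc, hη', Category.comp_id]
    apply pullback.hom_ext
    · simp [pullback.condition]
    · simp
  · intro X x m hm
    have c2 : (pullback.fst (x ≫ g) f ≫ x) ≫ g = pullback.snd (x ≫ g) f ≫ f := by
      rw [Category.assoc, pullback.condition]
    have c3 : pullback.fst (x ≫ g) f ≫ x = pullback.lift _ _ c2 ≫ pullback.fst g f := by simp
    obtain ⟨n, ⟨hn, hn'⟩, hu'⟩ := hu X (x ≫ g) (pullback.lift _ _ c3 ≫ m) (by
      rw [Category.assoc, reassoc_of% hm]; simp)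
    have c4 : x ≫ η = n ≫ a := by
      obtain ⟨q, -, hq⟩ := hv X (x ≫ g) (pullback.lift _ _ c2) (by simp)
      refine (hq _ ⟨by rw [Category.assoc, hη], ?_⟩).trans (hq _ ⟨by rw [Category.assoc, ha, hn], ?_⟩).symm
      · rw [bc_bc _ _ _ g _ _ hη rfl, Category.assoc, hη', Category.comp_id]
        rfl
      · rw [bc_bc _ _ _ _ _ _ ha hn, Category.assoc, ha', reassoc_of% hn', hm]
        simp
    refine ⟨pullback.lift _ _ c4, ⟨by simp, ?_⟩, ?_⟩
    · have e2 : bc (pullback.lift _ _ c4) (pullback.fst η a) x (pullback.fst g f) (by simp) ≫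
          pullback.lift _ _ c1 = pullback.lift (pullback.fst _ _)
            (pullback.snd _ _ ≫ pullback.snd g f) (by
              rw [pullback.condition_assoc, pullback.condition, Category.assoc]) ≫
            bc n π (x ≫ g) f hn := by
        apply pullback.hom_ext <;> simp [bc]
      rw [← Category.assoc, e2, Category.assoc, hn', ← Category.assoc]
      refine Eq.trans (congrArg (· ≫ m) ?_) (Category.id_comp m)
      apply pullback.hom_ext
      · simp
      · apply pullback.hom_ext <;> simp [pullback.condition]
    · rintro l ⟨hl, hl'⟩
      apply pullback.hom_ext
      · simpa using hl
      · rw [pullback.lift_snd]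
        have e4 : (l ≫ pullback.snd η a) ≫ π = x ≫ g := by
          rw [← ha, Category.assoc, ← pullback.condition_assoc, hη, reassoc_of% hl]
        refine hu' _ ⟨e4, ?_⟩
        rw [← hl', ← Category.assoc, ← Category.assoc]
        congr 1
        apply pullback.hom_ext <;> simp [bc]

/-- Exponentiable morphisms are stable under pullback. -/
theorem exponentiable_fst {A B A' : E} (f : B ⟶ A) (g : A' ⟶ A)
    [(Over.pullback f).IsLeftAdjoint] : (Over.pullback (pullback.fst g f)).IsLeftAdjoint :=
  isLeftAdjoint_of_hasDistributivityPullbacks _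
    ((hasDistributivityPullbacks_of_isLeftAdjoint f).baseChange g)

/-- Exponentiable morphisms are stable under composition. -/
theorem exponentiable_comp {A B C : E} (f : A ⟶ B) (g : B ⟶ C)
    [(Over.pullback f).IsLeftAdjoint] [(Over.pullback g).IsLeftAdjoint] :
    (Over.pullback (f ≫ g)).IsLeftAdjoint :=
  Functor.isLeftAdjoint_of_iso (Over.pullbackComp f g).symm

variable (E) in
/-- A polynomial `p : P_* ⟶ P` in `E`, i.e. an exponentiable morphism of `E`: one for which the
pullback functor `E/P ⥤ E/P_*` has a right adjoint. -/
structure Poly where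
  /-- the object of positions `P` -/
  pos : E
  /-- the object of directions `P_*` -/
  dir : E
  /-- the morphism `p : P_* ⟶ P` -/
  map : dir ⟶ pos
  exponentiable : (Over.pullback map).IsLeftAdjoint

attribute [instance] Poly.exponentiable

namespace Poly

/-- A morphism of polynomials `φ : p ⟶ q`: a morphism `φ₁ : P ⟶ Q` together with a morphism
`φ♯ : P ×_Q Q_* ⟶ P_*` over `P`. (Isomorphism classes of such diagrams are represented uniquely by
using the chosen pullback `P ×_Q Q_*`.) -/
structure Hom (p q : Poly E) where
  /-- the component on positions -/
  pos : p.pos ⟶ q.pos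
  /-- the component on directions -/
  dir : pullback pos q.map ⟶ p.dir
  w : dir ≫ p.map = pullback.fst pos q.map

/-- The action of `φ₁` on generalised positions `x : X ⟶ P`. -/
noncomputable def Hom.app {p q : Poly E} (φ : Hom p q) {X : E} (x : X ⟶ p.pos) : X ⟶ q.pos :=
  x ≫ φ.pos

/-- The action of `φ` on generalised directions: for `x : X ⟶ P` and `d : X ⟶ Q_*` over `φ₁ x`,
the element `φ♯ (x, d) : X ⟶ P_*` over `x`. -/
noncomputable def Hom.act {p q : Poly E} (φ : Hom p q) {X : E} (x : X ⟶ p.pos) (d : X ⟶ q.dir)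
    (h : d ≫ q.map = φ.app x) : X ⟶ p.dir :=
  pullback.lift x d (by rw [h, Hom.app]) ≫ φ.dir

@[simp] theorem Hom.comp_app {p q : Poly E} (φ : Hom p q) {X Y : E} (g : Y ⟶ X)
    (x : X ⟶ p.pos) : g ≫ φ.app x = φ.app (g ≫ x) := by
  simp [Hom.app]

@[simp] theorem Hom.act_map {p q : Poly E} (φ : Hom p q) {X : E} (x : X ⟶ p.pos)
    (d : X ⟶ q.dir) (h : d ≫ q.map = φ.app x) : φ.act x d h ≫ p.map = x := by
  rw [Hom.act, Category.assoc, φ.w, pullback.lift_fst]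

@[simp] theorem Hom.comp_act {p q : Poly E} (φ : Hom p q) {X Y : E} (g : Y ⟶ X) (x : X ⟶ p.pos)
    (d : X ⟶ q.dir) (h : d ≫ q.map = φ.app x) :
    g ≫ φ.act x d h = φ.act (g ≫ x) (g ≫ d) (by simp [h]) := by
  rw [Hom.act, Hom.act, ← Category.assoc]
  congr 1
  apply pullback.hom_ext <;> simp

theorem Hom.act_congr {p q : Poly E} (φ : Hom p q) {X : E} {x x' : X ⟶ p.pos}
    {d d' : X ⟶ q.dir} (hx : x = x') (hd : d = d') {h : d ≫ q.map = φ.app x}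
    {h' : d' ≫ q.map = φ.app x'} : φ.act x d h = φ.act x' d' h' := by
  subst hx hd
  rfl

theorem Hom.ext_elem {p q : Poly E} {φ ψ : Hom p q}
    (h : ∀ {X : E} (x : X ⟶ p.pos), φ.app x = ψ.app x)
    (h' : ∀ {X : E} (x : X ⟶ p.pos) (d : X ⟶ q.dir) (hφ : d ≫ q.map = φ.app x)
      (hψ : d ≫ q.map = ψ.app x), φ.act x d hφ = ψ.act x d hψ) : φ = ψ := by
  obtain ⟨a, b, w⟩ := φ
  obtain ⟨a', b', w'⟩ := ψ
  obtain rfl : a = a' := by simpa [Hom.app] using h (𝟙 _)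
  congr 1
  have := h' (pullback.fst a q.map) (pullback.snd a q.map) pullback.condition.symm
    pullback.condition.symm
  have e : pullback.lift (pullback.fst a q.map) (pullback.snd a q.map) pullback.condition =
    𝟙 _ := by apply pullback.hom_ext <;> simp
  simpa [Hom.act, e] using this

/-- A morphism of polynomials presented through its actions on generalised positions and
directions, natural in the stage of definition. -/
structure ElemHom (p q : Poly E) where
  /-- the action on positions -/
  app : ∀ {X : E}, (X ⟶ p.pos) → (X ⟶ q.pos)
  comp_app : ∀ {X Y : E} (g : Y ⟶ X) (x : X ⟶ p.pos), g ≫ app x = app (g ≫ x)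
  /-- the action on directions -/
  act : ∀ {X : E} (x : X ⟶ p.pos) (d : X ⟶ q.dir), d ≫ q.map = app x → (X ⟶ p.dir)
  comp_act : ∀ {X Y : E} (g : Y ⟶ X) (x : X ⟶ p.pos) (d : X ⟶ q.dir) (h : d ≫ q.map = app x),
    g ≫ act x d h = act (g ≫ x) (g ≫ d) (by rw [Category.assoc, h, comp_app])
  act_map : ∀ {X : E} (x : X ⟶ p.pos) (d : X ⟶ q.dir) (h : d ≫ q.map = app x),
    act x d h ≫ p.map = x

/-- The morphism of polynomials with given actions on generalised elements (by Yoneda). -/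
noncomputable def Hom.ofElem {p q : Poly E} (S : ElemHom p q) : Hom p q where
  pos := S.app (𝟙 p.pos)
  dir := S.act (pullback.fst (S.app (𝟙 p.pos)) q.map) (pullback.snd (S.app (𝟙 p.pos)) q.map)
    (by rw [← pullback.condition, S.comp_app, Category.comp_id])
  w := S.act_map ..

theorem Hom.ofElem_app {p q : Poly E} (S : ElemHom p q) {X : E} (x : X ⟶ p.pos) :
    (Hom.ofElem S).app x = S.app x := by
  rw [Hom.app, Hom.ofElem, S.comp_app, Category.comp_id]

theorem Hom.ofElem_act {p q : Poly E} (S : ElemHom p q) {X : E} (x : X ⟶ p.pos) (d : X ⟶ q.dir)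
    (h : d ≫ q.map = (Hom.ofElem S).app x) :
    (Hom.ofElem S).act x d h = S.act x d (by rw [h, Hom.ofElem_app]) := by
  have h' : x ≫ S.app (𝟙 p.pos) = d ≫ q.map := h.symm
  refine (S.comp_act (pullback.lift x d h') _ _ _).trans ?_
  congr 1
  · exact pullback.lift_fst ..
  · exact pullback.lift_snd ..

/-- The identity morphism of a polynomial. -/
noncomputable def Hom.id (p : Poly E) : Hom p p where
  pos := 𝟙 p.pos
  dir := pullback.snd (𝟙 p.pos) p.map
  w := by rw [← pullback.condition, Category.comp_id]

/-- The composite of morphisms of polynomials: `φ₁ ≫ ψ₁` on positions, and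
`(x, d) ↦ φ♯ (x, ψ♯ (φ₁ x, d))` on directions. -/
noncomputable def Hom.comp {p q r : Poly E} (φ : Hom p q) (ψ : Hom q r) : Hom p r where
  pos := φ.pos ≫ ψ.pos
  dir := φ.act (pullback.fst (φ.pos ≫ ψ.pos) r.map)
    (ψ.act (pullback.fst (φ.pos ≫ ψ.pos) r.map ≫ φ.pos) (pullback.snd (φ.pos ≫ ψ.pos) r.map)
      (by rw [Hom.app, Category.assoc, pullback.condition])) (Hom.act_map ..)
  w := Hom.act_map ..

@[simp] theorem Hom.id_app (p : Poly E) {X : E} (x : X ⟶ p.pos) : (Hom.id p).app x = x :=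
  Category.comp_id x

@[simp] theorem Hom.comp_app_eq {p q r : Poly E} (φ : Hom p q) (ψ : Hom q r) {X : E}
    (x : X ⟶ p.pos) : (φ.comp ψ).app x = ψ.app (φ.app x) :=
  (Category.assoc ..).symm

@[simp] theorem Hom.id_act (p : Poly E) {X : E} (x : X ⟶ p.pos) (d : X ⟶ p.dir)
    (h : d ≫ p.map = (Hom.id p).app x) : (Hom.id p).act x d h = d :=
  pullback.lift_snd ..

@[simp] theorem Hom.comp_act_eq {p q r : Poly E} (φ : Hom p q) (ψ : Hom q r) {X : E}
    (x : X ⟶ p.pos) (d : X ⟶ r.dir) (h : d ≫ r.map = (φ.comp ψ).app x) :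
    (φ.comp ψ).act x d h = φ.act x (ψ.act (φ.app x) d (by simpa using h))
      (by simp) := by
  have h' : x ≫ φ.pos ≫ ψ.pos = d ≫ r.map := h.symm
  refine (Hom.comp_act φ (pullback.lift x d h') _ _ (Hom.act_map ..)).trans ?_
  simp [Hom.app]

noncomputable instance : Category (Poly E) where
  Hom := Hom
  id := Hom.id
  comp := Hom.comp
  id_comp φ := Hom.ext_elem (by simp) (by simp)
  comp_id φ := Hom.ext_elem (by simp) (by simp)
  assoc φ ψ χ := Hom.ext_elem (by simp) (by simp)

theorem hom_ext {p q : Poly E} {φ ψ : p ⟶ q}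
    (h : ∀ {X : E} (x : X ⟶ p.pos), φ.app x = ψ.app x)
    (h' : ∀ {X : E} (x : X ⟶ p.pos) (d : X ⟶ q.dir) (hφ : d ≫ q.map = φ.app x)
      (hψ : d ≫ q.map = ψ.app x), φ.act x d hφ = ψ.act x d hψ) : φ = ψ :=
  Hom.ext_elem h h'

@[simp] theorem id_app (p : Poly E) {X : E} (x : X ⟶ p.pos) : Hom.app (𝟙 p) x = x :=
  Hom.id_app p x

@[simp] theorem comp_app {p q r : Poly E} (φ : p ⟶ q) (ψ : q ⟶ r) {X : E}
    (x : X ⟶ p.pos) : Hom.app (φ ≫ ψ) x = ψ.app (φ.app x) :=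
  Hom.comp_app_eq φ ψ x

@[simp] theorem id_act (p : Poly E) {X : E} (x : X ⟶ p.pos) (d : X ⟶ p.dir)
    (h : d ≫ p.map = Hom.app (𝟙 p) x) : Hom.act (𝟙 p) x d h = d :=
  Hom.id_act ..

@[simp] theorem comp_act {p q r : Poly E} (φ : p ⟶ q) (ψ : q ⟶ r) {X : E} (x : X ⟶ p.pos)
    (d : X ⟶ r.dir) (h : d ≫ r.map = Hom.app (φ ≫ ψ) x) :
    Hom.act (φ ≫ ψ) x d h = φ.act x (ψ.act (φ.app x) d (by simpa using h)) (by simp) :=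
  Hom.comp_act_eq ..

/-- The object `Π_p (Q × P_*)` of positions of `p ◁ q`. -/
noncomputable def triPos (p q : Poly E) : E :=
  ((Over.pullback p.map).rightAdjoint.obj (Over.mk (prod.snd : q.pos ⨯ p.dir ⟶ p.dir))).left

/-- The structure morphism `Π_p (Q × P_*) ⟶ P`. -/
noncomputable def triProj (p q : Poly E) : triPos p q ⟶ p.pos :=
  ((Over.pullback p.map).rightAdjoint.obj (Over.mk (prod.snd : q.pos ⨯ p.dir ⟶ p.dir))).hom

/-- The counit `Π_p (Q × P_*) ×_P P_* ⟶ Q × P_*` followed by the projection to `Q`. -/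
noncomputable def triEv (p q : Poly E) : pullback (triProj p q) p.map ⟶ q.pos :=
  ((Adjunction.ofIsLeftAdjoint (Over.pullback p.map)).counit.app
    (Over.mk (prod.snd : q.pos ⨯ p.dir ⟶ p.dir))).left ≫ prod.fst

/-- The object `(Π_p (Q × P_*) ×_P P_*) ×_Q Q_*` of directions of `p ◁ q`. -/
noncomputable abbrev triDir (p q : Poly E) : E := pullback (triEv p q) q.map

/-- The structure morphism of `p ◁ q`. -/
noncomputable def triMap (p q : Poly E) : triDir p q ⟶ triPos p q :=
  pullback.fst (triEv p q) q.map ≫ pullback.fst (triProj p q) p.map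

theorem exponentiable_triMap (p q : Poly E) : (Over.pullback (triMap p q)).IsLeftAdjoint :=
  have := exponentiable_fst p.map (triProj p q)
  have := exponentiable_fst q.map (triEv p q)
  exponentiable_comp (pullback.fst (triEv p q) q.map) (pullback.fst (triProj p q) p.map)

/-- The composition product `p ◁ q`. -/
noncomputable abbrev tri (p q : Poly E) : Poly E where
  pos := triPos p q
  dir := triDir p q
  map := triMap p q
  exponentiable := exponentiable_triMap p q

/-- The projection from the directions of `p ◁ q` to those of `p`. -/
noncomputable def triFst (p q : Poly E) : triDir p q ⟶ p.dir :=
  pullback.fst (triEv p q) q.map ≫ pullback.snd (triProj p q) p.map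

/-- The projection from the directions of `p ◁ q` to those of `q`. -/
noncomputable def triSnd (p q : Poly E) : triDir p q ⟶ q.dir :=
  pullback.snd (triEv p q) q.map

/-- A generalised position `b` of `p ◁ q` evaluated at a direction `y` of `p` over it. -/
noncomputable def evalAt {p q : Poly E} {X : E} (b : X ⟶ triPos p q) (y : X ⟶ p.dir)
    (h : y ≫ p.map = b ≫ triProj p q) : X ⟶ q.pos :=
  pullback.lift b y h.symm ≫ triEv p q

/-- The generalised position of `p ◁ q` given by `x : X ⟶ P` and `f : X ×_P P_* ⟶ Q`. -/
noncomputable def posMk {p q : Poly E} {X : E} (x : X ⟶ p.pos) (f : pullback x p.map ⟶ q.pos) :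
    X ⟶ triPos p q :=
  ((Adjunction.ofIsLeftAdjoint (Over.pullback p.map)).homEquiv (Over.mk x)
    (Over.mk (prod.snd : q.pos ⨯ p.dir ⟶ p.dir))
      (Over.homMk (prod.lift f (pullback.snd x p.map)) (prod.lift_snd _ _))).left

/-- The generalised direction of `p ◁ q` over `b` given by a direction `y` of `p` and a direction
`z` of `q` over `b` evaluated at `y`. -/
noncomputable def dirMk {p q : Poly E} {X : E} (b : X ⟶ triPos p q) (y : X ⟶ p.dir)
    (h : y ≫ p.map = b ≫ triProj p q) (z : X ⟶ q.dir) (h' : z ≫ q.map = evalAt b y h) :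
    X ⟶ triDir p q :=
  pullback.lift (pullback.lift b y h.symm) z (by rw [h', evalAt])

section

variable {p q : Poly E} {X Y : E}

theorem evalAt_congr {b b' : X ⟶ triPos p q} {y y' : X ⟶ p.dir}
    (hb : b = b') (hy : y = y') {h : y ≫ p.map = b ≫ triProj p q}
    {h' : y' ≫ p.map = b' ≫ triProj p q} : evalAt b y h = evalAt b' y' h' := by
  subst hb hy
  rfl

@[simp] theorem comp_evalAt (g : Y ⟶ X) (b : X ⟶ triPos p q) (y : X ⟶ p.dir)
    (h : y ≫ p.map = b ≫ triProj p q) :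
    g ≫ evalAt b y h = evalAt (g ≫ b) (g ≫ y)
      (by rw [Category.assoc, Category.assoc, h]) := by
  rw [evalAt, evalAt, ← Category.assoc]
  congr 1
  apply pullback.hom_ext <;> simp

@[simp] theorem posMk_proj (x : X ⟶ p.pos) (f : pullback x p.map ⟶ q.pos) :
    posMk x f ≫ triProj p q = x :=
  Over.w ((Adjunction.ofIsLeftAdjoint (Over.pullback p.map)).homEquiv (Over.mk x)
    (Over.mk (prod.snd : q.pos ⨯ p.dir ⟶ p.dir))
      (Over.homMk (prod.lift f (pullback.snd x p.map)) (prod.lift_snd _ _)))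

theorem bc_posMk (x : X ⟶ p.pos) (f : pullback x p.map ⟶ q.pos) :
    bc (posMk x f) (triProj p q) x p.map (posMk_proj x f) ≫ triEv p q = f := by
  have h := congrArg (fun k => k.left ≫ prod.fst)
    (((Adjunction.ofIsLeftAdjoint (Over.pullback p.map)).homEquiv (Over.mk x)
    (Over.mk (prod.snd : q.pos ⨯ p.dir ⟶ p.dir))).symm_apply_apply
      (Over.homMk (prod.lift f (pullback.snd x p.map)) (prod.lift_snd _ _)))
  rw [Adjunction.homEquiv_counit] at h
  refine Eq.trans ?_ (h.trans (prod.lift_fst _ _))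
  exact (Category.assoc ..).symm

theorem evalAt_comp_posMk (g : Y ⟶ X) (x : X ⟶ p.pos) (f : pullback x p.map ⟶ q.pos)
    (y : Y ⟶ p.dir) (h : y ≫ p.map = (g ≫ posMk x f) ≫ triProj p q) :
    evalAt (g ≫ posMk x f) y h = pullback.lift g y (by simpa using h.symm) ≫ f := by
  have e : pullback.lift (g ≫ posMk x f) y h.symm = pullback.lift g y (by simpa using h.symm) ≫
      bc (posMk x f) (triProj p q) x p.map (posMk_proj x f) := by
    apply pullback.hom_ext <;> simp [bc]
  rw [evalAt, e, Category.assoc, bc_posMk]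

@[simp] theorem evalAt_posMk (x : X ⟶ p.pos) (f : pullback x p.map ⟶ q.pos)
    (y : X ⟶ p.dir) (h : y ≫ p.map = posMk x f ≫ triProj p q) :
    evalAt (posMk x f) y h = pullback.lift (𝟙 X) y (by simpa using h.symm) ≫ f := by
  simpa using evalAt_comp_posMk (𝟙 X) x f y (by simpa using h)

theorem pos_ext {b b' : X ⟶ triPos p q} (h : b ≫ triProj p q = b' ≫ triProj p q)
    (h' : ∀ {W : E} (w : W ⟶ X) (y : W ⟶ p.dir) (hb : y ≫ p.map = (w ≫ b) ≫ triProj p q)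
      (hb' : y ≫ p.map = (w ≫ b') ≫ triProj p q), evalAt (w ≫ b) y hb = evalAt (w ≫ b') y hb') :
    b = b' := by
  let adj := Adjunction.ofIsLeftAdjoint (Over.pullback p.map)
  let Z : Over p.dir := Over.mk (prod.snd : q.pos ⨯ p.dir ⟶ p.dir)
  let β : Over.mk (b ≫ triProj p q) ⟶ (Over.pullback p.map).rightAdjoint.obj Z := Over.homMk b rfl
  let β' : Over.mk (b ≫ triProj p q) ⟶ (Over.pullback p.map).rightAdjoint.obj Z :=
    Over.homMk b' h.symm
  have key : (adj.homEquiv _ _).symm β = (adj.homEquiv _ _).symm β' := by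
    ext
    apply prod.hom_ext
    · rw [adj.homEquiv_counit, adj.homEquiv_counit]
      have := h' (pullback.fst (b ≫ triProj p q) p.map) (pullback.snd (b ≫ triProj p q) p.map)
        (by rw [Category.assoc, pullback.condition])
        (by rw [Category.assoc, ← h, pullback.condition])
      simp only [evalAt] at this
      exact (Category.assoc ..).trans (this.trans (Category.assoc ..).symm)
    · exact (Over.w ((adj.homEquiv _ Z).symm β)).trans (Over.w ((adj.homEquiv _ Z).symm β')).symm
  exact congrArg (fun k => k.left) ((adj.homEquiv _ _).symm.injective key)

@[simp] theorem comp_posMk (g : Y ⟶ X) (x : X ⟶ p.pos) (f : pullback x p.map ⟶ q.pos) :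
    g ≫ posMk (q := q) x f = posMk (g ≫ x) (bc g x (g ≫ x) p.map rfl ≫ f) := by
  apply pos_ext
  · simp
  · intro W w y hb hb'
    have e := evalAt_comp_posMk (w ≫ g) x f y (by simpa using hb)
    rw [evalAt_comp_posMk]
    simp only [Category.assoc] at e
    refine e.trans (Eq.trans ?_ (Category.assoc ..))
    congr 1
    apply pullback.hom_ext <;> simp [bc]

@[simp] theorem dirMk_map (b : X ⟶ triPos p q) (y : X ⟶ p.dir)
    (h : y ≫ p.map = b ≫ triProj p q) (z : X ⟶ q.dir) (h' : z ≫ q.map = evalAt b y h) :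
    dirMk b y h z h' ≫ triMap p q = b := by
  simp [dirMk, triMap]

@[simp] theorem dirMk_fst (b : X ⟶ triPos p q) (y : X ⟶ p.dir)
    (h : y ≫ p.map = b ≫ triProj p q) (z : X ⟶ q.dir) (h' : z ≫ q.map = evalAt b y h) :
    dirMk b y h z h' ≫ triFst p q = y := by
  simp [dirMk, triFst]

@[simp] theorem dirMk_snd (b : X ⟶ triPos p q) (y : X ⟶ p.dir)
    (h : y ≫ p.map = b ≫ triProj p q) (z : X ⟶ q.dir) (h' : z ≫ q.map = evalAt b y h) :
    dirMk b y h z h' ≫ triSnd p q = z := by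
  simp [dirMk, triSnd]

theorem dir_ext {d d' : X ⟶ triDir p q} (h : d ≫ triMap p q = d' ≫ triMap p q)
    (h₁ : d ≫ triFst p q = d' ≫ triFst p q) (h₂ : d ≫ triSnd p q = d' ≫ triSnd p q) : d = d' := by
  apply pullback.hom_ext
  · apply pullback.hom_ext
    · simpa [triMap] using h
    · simpa [triFst] using h₁
  · exact h₂

theorem triFst_map (p q : Poly E) : triFst p q ≫ p.map = triMap p q ≫ triProj p q := by
  simp [triFst, triMap, pullback.condition]

theorem triSnd_map (p q : Poly E) :
    triSnd p q ≫ q.map = evalAt (triMap p q) (triFst p q) (triFst_map p q) := by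
  rw [triSnd, ← pullback.condition, evalAt]
  congr 1
  apply pullback.hom_ext <;> simp [triMap, triFst]

@[simp] theorem comp_dirMk (g : Y ⟶ X) (b : X ⟶ triPos p q) (y : X ⟶ p.dir)
    (h : y ≫ p.map = b ≫ triProj p q) (z : X ⟶ q.dir) (h' : z ≫ q.map = evalAt b y h) :
    g ≫ dirMk b y h z h' = dirMk (g ≫ b) (g ≫ y) (by rw [Category.assoc, Category.assoc, h])
      (g ≫ z) (by rw [Category.assoc, h', comp_evalAt]) := by
  apply dir_ext <;> simp

end

section

variable {p q r : Poly E} {X Y Z : E}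

/-- The first component of a generalised direction `d` of `p ◁ q` lies over the first component
of the position. -/
theorem fst_map {b : X ⟶ triPos p q} {d : X ⟶ triDir p q} (h : d ≫ triMap p q = b) :
    (d ≫ triFst p q) ≫ p.map = b ≫ triProj p q := by
  rw [Category.assoc, triFst_map, ← Category.assoc, h]

theorem snd_map {b : X ⟶ triPos p q} {d : X ⟶ triDir p q} (h : d ≫ triMap p q = b) :
    (d ≫ triSnd p q) ≫ q.map = evalAt b (d ≫ triFst p q) (fst_map h) := by
  subst h
  rw [Category.assoc, triSnd_map, comp_evalAt]

theorem posMk_eval (x : X ⟶ p.pos) (f : pullback x p.map ⟶ q.pos) (y : X ⟶ p.dir)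
    (h : y ≫ p.map = posMk x f ≫ triProj p q) (z : X ⟶ q.pos)
    (hz : ∀ h', pullback.lift (𝟙 X) y h' ≫ f = z) : evalAt (posMk x f) y h = z := by
  rw [evalAt_posMk, hz]

theorem comp_posMk_eq (g : Y ⟶ X) (x : X ⟶ p.pos) (f : pullback x p.map ⟶ q.pos)
    (x' : Y ⟶ p.pos) (f' : pullback x' p.map ⟶ q.pos) (hx : g ≫ x = x')
    (hf : bc g x x' p.map hx ≫ f = f') : g ≫ posMk (q := q) x f = posMk x' f' := by
  subst hx hf
  rw [comp_posMk]

/-- Homomorphisms into `p ◁ q` are determined by the values of the positions and by directions. -/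
theorem hom_tri_ext {φ ψ : r ⟶ tri p q}
    (h : ∀ {X : E} (x : X ⟶ r.pos), φ.app x ≫ triProj p q = ψ.app x ≫ triProj p q)
    (h' : ∀ {X : E} (x : X ⟶ r.pos) (y : X ⟶ p.dir) (hy : y ≫ p.map = φ.app x ≫ triProj p q)
      (hy' : y ≫ p.map = ψ.app x ≫ triProj p q), evalAt (φ.app x) y hy = evalAt (ψ.app x) y hy')
    (h'' : ∀ {X : E} (x : X ⟶ r.pos) (d : X ⟶ triDir p q) (hφ : d ≫ triMap p q = φ.app x)
      (hψ : d ≫ triMap p q = ψ.app x), φ.act x d hφ = ψ.act x d hψ) : φ = ψ :=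
  hom_ext (fun x => pos_ext (h x) fun w y hy hy' => by
    rw [evalAt_congr (Hom.comp_app φ w x) rfl (h' := by rw [hy, Hom.comp_app]),
      evalAt_congr (Hom.comp_app ψ w x) rfl (h' := by rw [hy', Hom.comp_app])]
    exact h' ..) h''

end

/-! ### The composition product on morphisms -/

section

variable {p p' q q' : Poly E} (φ : p ⟶ p') (ψ : q ⟶ q') {X Y : E}

theorem triHom_aux (b : X ⟶ triPos p q) (y : X ⟶ p'.dir)
    (h : y ≫ p'.map = φ.app (b ≫ triProj p q)) :
    φ.act (b ≫ triProj p q) y h ≫ p.map = b ≫ triProj p q :=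
  Hom.act_map ..

/-- The value of `(φ ◁ ψ) (b)` at `y`: the image under `ψ` of the value of `b` at `φ♯ y`. -/
noncomputable def triEval (b : X ⟶ triPos p q) (y : X ⟶ p'.dir)
    (h : y ≫ p'.map = φ.app (b ≫ triProj p q)) : X ⟶ q'.pos :=
  ψ.app (evalAt b (φ.act (b ≫ triProj p q) y h) (triHom_aux φ b y h))

theorem comp_triEval_eq (g : Y ⟶ X) (b : X ⟶ triPos p q) (y : X ⟶ p'.dir)
    (h : y ≫ p'.map = φ.app (b ≫ triProj p q)) {b' : Y ⟶ triPos p q} {y' : Y ⟶ p'.dir}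
    (hb : g ≫ b = b') (hy : g ≫ y = y') (h' : y' ≫ p'.map = φ.app (b' ≫ triProj p q)) :
    g ≫ triEval φ ψ b y h = triEval φ ψ b' y' h' := by
  subst hb hy
  rw [triEval, triEval, Hom.comp_app, comp_evalAt]
  congr 1
  refine evalAt_congr rfl ?_
  rw [Hom.comp_act]
  exact Hom.act_congr _ (Category.assoc ..).symm rfl

theorem triHom_aux₂ (b : X ⟶ triPos p q) :
    pullback.snd (φ.app (b ≫ triProj p q)) p'.map ≫ p'.map =
      φ.app ((pullback.fst (φ.app (b ≫ triProj p q)) p'.map ≫ b) ≫ triProj p q) := by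
  rw [← pullback.condition, Hom.comp_app, Category.assoc]

/-- The action of `φ ◁ ψ` on positions. -/
noncomputable def triApp (b : X ⟶ triPos p q) : X ⟶ triPos p' q' :=
  posMk (φ.app (b ≫ triProj p q)) (triEval φ ψ (pullback.fst _ _ ≫ b) (pullback.snd _ _)
    (triHom_aux₂ φ b))

theorem triApp_proj (b : X ⟶ triPos p q) :
    triApp φ ψ b ≫ triProj p' q' = φ.app (b ≫ triProj p q) :=
  posMk_proj ..

theorem evalAt_triApp (b : X ⟶ triPos p q) (y : X ⟶ p'.dir)
    (h : y ≫ p'.map = triApp φ ψ b ≫ triProj p' q') :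
    evalAt (triApp φ ψ b) y h = triEval φ ψ b y (h.trans (triApp_proj φ ψ b)) :=
  posMk_eval _ _ _ _ _ fun h' =>
    comp_triEval_eq _ _ _ _ _ _ (by rw [pullback.lift_fst_assoc, Category.id_comp])
      (pullback.lift_snd ..) _

theorem comp_triApp (g : Y ⟶ X) (b : X ⟶ triPos p q) :
    g ≫ triApp φ ψ b = triApp φ ψ (g ≫ b) :=
  comp_posMk_eq _ _ _ _ _ (by rw [Hom.comp_app, Category.assoc])
    (comp_triEval_eq _ _ _ _ _ _ (by simp [bc]) (bc_snd ..) _)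

theorem triHom_aux₃ (b : X ⟶ triPos p q) (d : X ⟶ triDir p' q')
    (h : d ≫ triMap p' q' = triApp φ ψ b) :
    (d ≫ triFst p' q') ≫ p'.map = φ.app (b ≫ triProj p q) :=
  (fst_map h).trans (triApp_proj ..)

theorem triHom_aux₄ (b : X ⟶ triPos p q) (d : X ⟶ triDir p' q')
    (h : d ≫ triMap p' q' = triApp φ ψ b) : (d ≫ triSnd p' q') ≫ q'.map =
      ψ.app (evalAt b (φ.act (b ≫ triProj p q) (d ≫ triFst p' q') (triHom_aux₃ φ ψ b d h))
        (Hom.act_map ..)) :=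
  (snd_map h).trans (evalAt_triApp ..)

/-- The composition product of two morphisms of polynomials. -/
noncomputable def triHom : tri p q ⟶ tri p' q' :=
  Hom.ofElem {
    app := fun b => triApp φ ψ b
    comp_app := fun g b => comp_triApp φ ψ g b
    act := fun b d h => dirMk b
      (φ.act (b ≫ triProj p q) (d ≫ triFst p' q') (triHom_aux₃ φ ψ b d h)) (Hom.act_map ..)
      (ψ.act (evalAt b (φ.act (b ≫ triProj p q) (d ≫ triFst p' q') (triHom_aux₃ φ ψ b d h))
        (Hom.act_map ..)) (d ≫ triSnd p' q') (triHom_aux₄ φ ψ b d h)) (Hom.act_map ..)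
    comp_act := fun g b d h => dir_ext (by rw [Category.assoc, dirMk_map, dirMk_map])
      (by
        rw [Category.assoc, dirMk_fst, dirMk_fst, Hom.comp_act]
        exact Hom.act_congr _ (Category.assoc ..).symm (Category.assoc ..).symm)
      (by
        rw [Category.assoc, dirMk_snd, dirMk_snd, Hom.comp_act]
        refine Hom.act_congr _ ?_ (Category.assoc ..).symm
        rw [comp_evalAt]
        refine evalAt_congr rfl ?_
        rw [Hom.comp_act]
        exact Hom.act_congr _ (Category.assoc ..).symm (Category.assoc ..).symm)
    act_map := fun b d h => dirMk_map .. }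

theorem triHom_app (b : X ⟶ triPos p q) : (triHom φ ψ).app b = triApp φ ψ b :=
  Hom.ofElem_app ..

theorem triHom_act (b : X ⟶ triPos p q) (d : X ⟶ triDir p' q')
    (h : d ≫ triMap p' q' = (triHom φ ψ).app b) : (triHom φ ψ).act b d h = dirMk b
      (φ.act (b ≫ triProj p q) (d ≫ triFst p' q')
        (triHom_aux₃ φ ψ b d (h.trans (triHom_app φ ψ b)))) (Hom.act_map ..)
      (ψ.act (evalAt b (φ.act (b ≫ triProj p q) (d ≫ triFst p' q')
        (triHom_aux₃ φ ψ b d (h.trans (triHom_app φ ψ b)))) (Hom.act_map ..))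
        (d ≫ triSnd p' q') (triHom_aux₄ φ ψ b d (h.trans (triHom_app φ ψ b))))
      (Hom.act_map ..) :=
  Hom.ofElem_act ..

end

/-! ### Unit and unitors -/

variable (E) in
/-- The identity polynomial `y`, given by the identity of the terminal object. -/
noncomputable abbrev unit : Poly E where
  pos := ⊤_ E
  dir := ⊤_ E
  map := 𝟙 _
  exponentiable := Functor.isLeftAdjoint_of_iso (Over.pullbackId (X := ⊤_ E)).symm

/-- The left unitor `y ◁ p ⟶ p`, evaluating a position at the unique direction of `y`. -/
noncomputable def leftUnitorHom (p : Poly E) : tri (unit E) p ⟶ p :=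
  Hom.ofElem {
    app := fun b => evalAt b (terminal.from _) (terminal.hom_ext ..)
    comp_app := fun g b => by
      rw [comp_evalAt]
      exact evalAt_congr rfl (terminal.hom_ext ..)
    act := fun b d h => dirMk b (terminal.from _) (terminal.hom_ext ..) d h
    comp_act := fun g b d h => dir_ext (by rw [Category.assoc, dirMk_map, dirMk_map])
      (terminal.hom_ext ..) (by rw [Category.assoc, dirMk_snd, dirMk_snd])
    act_map := fun b d h => dirMk_map .. }

/-- The inverse of the left unitor. -/
noncomputable def leftUnitorInv (p : Poly E) : p ⟶ tri (unit E) p :=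
  Hom.ofElem {
    app := fun x => posMk (terminal.from _) (pullback.fst _ _ ≫ x)
    comp_app := fun _ _ => comp_posMk_eq _ _ _ _ _ (terminal.hom_ext ..) (by simp [bc])
    act := fun _ d _ => d ≫ triSnd (unit E) p
    comp_act := fun _ _ _ _ => (Category.assoc ..).symm
    act_map := fun _ _ h => (snd_map h).trans
      (posMk_eval _ _ _ _ _ fun h' => by rw [pullback.lift_fst_assoc, Category.id_comp]) }

/-- The right unitor `p ◁ y ⟶ p`. -/
noncomputable def rightUnitorHom (p : Poly E) : tri p (unit E) ⟶ p :=
  Hom.ofElem {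
    app := fun b => b ≫ triProj p (unit E)
    comp_app := fun _ _ => (Category.assoc ..).symm
    act := fun b d h => dirMk b d h (terminal.from _) (terminal.hom_ext ..)
    comp_act := fun g b d h => dir_ext (by rw [Category.assoc, dirMk_map, dirMk_map])
      (by rw [Category.assoc, dirMk_fst, dirMk_fst]) (terminal.hom_ext ..)
    act_map := fun b d h => dirMk_map .. }

/-- The inverse of the right unitor. -/
noncomputable def rightUnitorInv (p : Poly E) : p ⟶ tri p (unit E) :=
  Hom.ofElem {
    app := fun x => posMk x (terminal.from _)
    comp_app := fun _ _ => comp_posMk_eq _ _ _ _ _ rfl (terminal.hom_ext ..)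
    act := fun _ d _ => d ≫ triFst p (unit E)
    comp_act := fun _ _ _ _ => (Category.assoc ..).symm
    act_map := fun _ _ h => (fst_map h).trans (posMk_proj ..) }

section

variable {X : E} (p : Poly E)

theorem leftUnitorHom_app (b : X ⟶ triPos (unit E) p) :
    (leftUnitorHom p).app b = evalAt b (terminal.from _) (terminal.hom_ext ..) :=
  Hom.ofElem_app ..

theorem leftUnitorHom_act (b : X ⟶ triPos (unit E) p) (d : X ⟶ p.dir)
    (h : d ≫ p.map = (leftUnitorHom p).app b) : (leftUnitorHom p).act b d h =
      dirMk b (terminal.from _) (terminal.hom_ext ..) d (h.trans (leftUnitorHom_app p b)) :=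
  Hom.ofElem_act ..

theorem evalAt_leftUnitorInv_app (x : X ⟶ p.pos) (y : X ⟶ ⊤_ E)
    (h : y ≫ 𝟙 _ = (leftUnitorInv p).app x ≫ triProj (unit E) p) :
    evalAt ((leftUnitorInv p).app x) y h = x :=
  (evalAt_congr (Hom.ofElem_app _ x) rfl (h' := terminal.hom_ext ..)).trans
    (posMk_eval _ _ _ _ _ fun h' => by rw [pullback.lift_fst_assoc, Category.id_comp])

theorem leftUnitorInv_act (x : X ⟶ p.pos) (d : X ⟶ triDir (unit E) p)
    (h : d ≫ triMap (unit E) p = (leftUnitorInv p).app x) :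
    (leftUnitorInv p).act x d h = d ≫ triSnd (unit E) p :=
  Hom.ofElem_act ..

theorem rightUnitorHom_app (b : X ⟶ triPos p (unit E)) :
    (rightUnitorHom p).app b = b ≫ triProj p (unit E) :=
  Hom.ofElem_app ..

theorem rightUnitorHom_act (b : X ⟶ triPos p (unit E)) (d : X ⟶ p.dir)
    (h : d ≫ p.map = (rightUnitorHom p).app b) : (rightUnitorHom p).act b d h =
      dirMk b d (h.trans (rightUnitorHom_app p b)) (terminal.from _) (terminal.hom_ext ..) :=
  Hom.ofElem_act ..

theorem rightUnitorInv_app_proj (x : X ⟶ p.pos) :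
    (rightUnitorInv p).app x ≫ triProj p (unit E) = x :=
  (congrArg (· ≫ triProj p (unit E)) (Hom.ofElem_app _ x)).trans (posMk_proj ..)

theorem rightUnitorInv_act (x : X ⟶ p.pos) (d : X ⟶ triDir p (unit E))
    (h : d ≫ triMap p (unit E) = (rightUnitorInv p).app x) :
    (rightUnitorInv p).act x d h = d ≫ triFst p (unit E) :=
  Hom.ofElem_act ..

end

/-! ### The associator -/

section

variable {p q r : Poly E} {X Y : E}

theorem dirMk_congr {b b' : X ⟶ triPos p q} {y y' : X ⟶ p.dir} {z z' : X ⟶ q.dir}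
    (hb : b = b') (hy : y = y') (hz : z = z') {h : y ≫ p.map = b ≫ triProj p q}
    {h₁ : z ≫ q.map = evalAt b y h} {h' : y' ≫ p.map = b' ≫ triProj p q}
    {h₁' : z' ≫ q.map = evalAt b' y' h'} : dirMk b y h z h₁ = dirMk b' y' h' z' h₁' := by
  subst hb hy hz
  rfl

theorem comp_evalAt_eq (g : Y ⟶ X) (b : X ⟶ triPos p q) (y : X ⟶ p.dir)
    (h : y ≫ p.map = b ≫ triProj p q) {b' : Y ⟶ triPos p q} {y' : Y ⟶ p.dir}
    (hb : g ≫ b = b') (hy : g ≫ y = y') (h' : y' ≫ p.map = b' ≫ triProj p q) :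
    g ≫ evalAt b y h = evalAt b' y' h' := by
  subst hb hy
  rw [comp_evalAt]

theorem comp_dirMk_eq (g : Y ⟶ X) (b : X ⟶ triPos p q) (y : X ⟶ p.dir)
    (h : y ≫ p.map = b ≫ triProj p q) (z : X ⟶ q.dir) (h₁ : z ≫ q.map = evalAt b y h)
    {b' : Y ⟶ triPos p q} {y' : Y ⟶ p.dir} {z' : Y ⟶ q.dir}
    (hb : g ≫ b = b') (hy : g ≫ y = y') (hz : g ≫ z = z')
    (h' : y' ≫ p.map = b' ≫ triProj p q) (h₁' : z' ≫ q.map = evalAt b' y' h') :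
    g ≫ dirMk b y h z h₁ = dirMk b' y' h' z' h₁' := by
  subst hb hy hz
  rw [comp_dirMk]

theorem assoc_aux₁ (b : X ⟶ triPos (tri p q) r) (y : X ⟶ p.dir)
    (h : y ≫ p.map = (b ≫ triProj (tri p q) r) ≫ triProj p q) (g : Y ⟶ X) :
    (g ≫ y) ≫ p.map = ((g ≫ b) ≫ triProj (tri p q) r) ≫ triProj p q := by
  simp only [Category.assoc] at h ⊢
  rw [h]

theorem assoc_aux₂ (b : X ⟶ triPos (tri p q) r) (y : X ⟶ p.dir)
    (h : y ≫ p.map = (b ≫ triProj (tri p q) r) ≫ triProj p q) :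
    pullback.snd (evalAt (b ≫ triProj (tri p q) r) y h) q.map ≫ q.map =
      evalAt ((pullback.fst (evalAt (b ≫ triProj (tri p q) r) y h) q.map ≫ b) ≫
        triProj (tri p q) r) (pullback.fst _ _ ≫ y) (assoc_aux₁ b y h _) := by
  rw [← pullback.condition]
  exact comp_evalAt_eq _ _ _ _ (Category.assoc ..).symm rfl _

/-- The value at `y` of the position of `p ◁ (q ◁ r)` corresponding to `b`. -/
noncomputable def assocEval (b : X ⟶ triPos (tri p q) r) (y : X ⟶ p.dir)
    (h : y ≫ p.map = (b ≫ triProj (tri p q) r) ≫ triProj p q) : X ⟶ triPos q r :=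
  posMk (evalAt (b ≫ triProj (tri p q) r) y h)
    (evalAt (pullback.fst _ _ ≫ b)
      (dirMk ((pullback.fst _ _ ≫ b) ≫ triProj (tri p q) r) (pullback.fst _ _ ≫ y)
        (assoc_aux₁ b y h _) (pullback.snd _ _) (assoc_aux₂ b y h)) (dirMk_map ..))

theorem assocEval_proj (b : X ⟶ triPos (tri p q) r) (y : X ⟶ p.dir)
    (h : y ≫ p.map = (b ≫ triProj (tri p q) r) ≫ triProj p q) :
    assocEval b y h ≫ triProj q r = evalAt (b ≫ triProj (tri p q) r) y h :=
  posMk_proj ..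

theorem evalAt_assocEval (b : X ⟶ triPos (tri p q) r) (y : X ⟶ p.dir)
    (h : y ≫ p.map = (b ≫ triProj (tri p q) r) ≫ triProj p q) (z : X ⟶ q.dir)
    (h' : z ≫ q.map = assocEval b y h ≫ triProj q r) : evalAt (assocEval b y h) z h' =
      evalAt b (dirMk (b ≫ triProj (tri p q) r) y h z (h'.trans (assocEval_proj b y h)))
        (dirMk_map ..) :=
  have e {Z : E} (k : X ⟶ Z) (h₂) : pullback.lift (𝟙 X) z h₂ ≫
      pullback.fst (evalAt (b ≫ triProj (tri p q) r) y h) q.map ≫ k = k := by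
    rw [pullback.lift_fst_assoc, Category.id_comp]
  posMk_eval _ _ _ _ _ fun h₂ => comp_evalAt_eq _ _ _ _ (e b h₂)
    (comp_dirMk_eq _ _ _ _ _ _ ((Category.assoc ..).symm.trans (congrArg (· ≫ _) (e b h₂)))
      (e y h₂) (pullback.lift_snd ..) _ _) _

theorem comp_assocEval_eq (g : Y ⟶ X) (b : X ⟶ triPos (tri p q) r) (y : X ⟶ p.dir)
    (h : y ≫ p.map = (b ≫ triProj (tri p q) r) ≫ triProj p q) {b' : Y ⟶ triPos (tri p q) r}
    {y' : Y ⟶ p.dir} (hb : g ≫ b = b') (hy : g ≫ y = y')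
    (h' : y' ≫ p.map = (b' ≫ triProj (tri p q) r) ≫ triProj p q) :
    g ≫ assocEval b y h = assocEval b' y' h' := by
  subst hb hy
  have e {Z : E} (k : X ⟶ Z) {x'} (hx) :
      bc g (evalAt (b ≫ triProj (tri p q) r) y h) x' q.map hx ≫ pullback.fst _ _ ≫ k =
        pullback.fst _ _ ≫ g ≫ k := by
    simp [bc]
  refine comp_posMk_eq _ _ _ _ _ (comp_evalAt_eq _ _ _ _ (Category.assoc ..).symm rfl _)
    (comp_evalAt_eq _ _ _ _ (e b _) (comp_dirMk_eq _ _ _ _ _ _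
      ((Category.assoc ..).symm.trans (congrArg (· ≫ _) (e b _))) (e y _) (bc_snd ..) _ _) _)

theorem assoc_aux₃ (b : X ⟶ triPos (tri p q) r) :
    pullback.snd ((b ≫ triProj (tri p q) r) ≫ triProj p q) p.map ≫ p.map =
      ((pullback.fst ((b ≫ triProj (tri p q) r) ≫ triProj p q) p.map ≫ b) ≫
        triProj (tri p q) r) ≫ triProj p q := by
  simp only [← pullback.condition, Category.assoc]

/-- The action of the associator on positions. -/
noncomputable def assocApp (b : X ⟶ triPos (tri p q) r) : X ⟶ triPos p (tri q r) :=
  posMk ((b ≫ triProj (tri p q) r) ≫ triProj p q)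
    (assocEval (pullback.fst _ _ ≫ b) (pullback.snd _ _) (assoc_aux₃ b))

theorem assocApp_proj (b : X ⟶ triPos (tri p q) r) :
    assocApp b ≫ triProj p (tri q r) = (b ≫ triProj (tri p q) r) ≫ triProj p q :=
  posMk_proj ..

theorem evalAt_assocApp (b : X ⟶ triPos (tri p q) r) (y : X ⟶ p.dir)
    (h : y ≫ p.map = assocApp b ≫ triProj p (tri q r)) :
    evalAt (assocApp b) y h = assocEval b y (h.trans (assocApp_proj b)) :=
  posMk_eval (q := tri q r) _ _ _ _ _ fun h' => comp_assocEval_eq _ _ _ _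
    (by rw [pullback.lift_fst_assoc, Category.id_comp]) (pullback.lift_snd ..) _

theorem comp_assocApp (g : Y ⟶ X) (b : X ⟶ triPos (tri p q) r) :
    g ≫ assocApp b = assocApp (g ≫ b) :=
  comp_posMk_eq (q := tri q r) _ _ _ _ _ (by simp only [Category.assoc])
    (comp_assocEval_eq _ _ _ _ (by simp [bc]) (bc_snd ..) _)

theorem assoc_aux₄ (b : X ⟶ triPos (tri p q) r) (d : X ⟶ triDir p (tri q r))
    (h : d ≫ triMap p (tri q r) = assocApp b) :
    (d ≫ triFst p (tri q r)) ≫ p.map = (b ≫ triProj (tri p q) r) ≫ triProj p q :=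
  (fst_map h).trans (assocApp_proj b)

theorem assoc_aux₅ (b : X ⟶ triPos (tri p q) r) (d : X ⟶ triDir p (tri q r))
    (h : d ≫ triMap p (tri q r) = assocApp b) : (d ≫ triSnd p (tri q r)) ≫ triMap q r =
    assocEval b (d ≫ triFst p (tri q r)) (assoc_aux₄ b d h) :=
  (snd_map h).trans (evalAt_assocApp ..)

theorem assoc_aux₆ (b : X ⟶ triPos (tri p q) r) (d : X ⟶ triDir p (tri q r))
    (h : d ≫ triMap p (tri q r) = assocApp b) : ((d ≫ triSnd p (tri q r)) ≫ triFst q r) ≫ q.map =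
    evalAt (b ≫ triProj (tri p q) r) (d ≫ triFst p (tri q r)) (assoc_aux₄ b d h) :=
  (fst_map (assoc_aux₅ b d h)).trans (assocEval_proj ..)

theorem assoc_aux₇ (b : X ⟶ triPos (tri p q) r) (d : X ⟶ triDir p (tri q r))
    (h : d ≫ triMap p (tri q r) = assocApp b) : ((d ≫ triSnd p (tri q r)) ≫ triSnd q r) ≫ r.map =
    evalAt b (dirMk (b ≫ triProj (tri p q) r) (d ≫ triFst p (tri q r)) (assoc_aux₄ b d h)
      ((d ≫ triSnd p (tri q r)) ≫ triFst q r) (assoc_aux₆ b d h)) (dirMk_map ..) :=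
  (snd_map (assoc_aux₅ b d h)).trans (evalAt_assocEval ..)

/-- The action of the associator on directions: `(y, (z, w)) ↦ ((y, z), w)`. -/
noncomputable def assocAct (b : X ⟶ triPos (tri p q) r) (d : X ⟶ triDir p (tri q r))
    (h : d ≫ triMap p (tri q r) = assocApp b) : X ⟶ triDir (tri p q) r :=
  dirMk b (dirMk (b ≫ triProj (tri p q) r) (d ≫ triFst p (tri q r)) (assoc_aux₄ b d h)
      ((d ≫ triSnd p (tri q r)) ≫ triFst q r) (assoc_aux₆ b d h)) (dirMk_map ..)
    ((d ≫ triSnd p (tri q r)) ≫ triSnd q r) (assoc_aux₇ b d h)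

theorem comp_assocAct (b : X ⟶ triPos (tri p q) r) (d : X ⟶ triDir p (tri q r))
    (h : d ≫ triMap p (tri q r) = assocApp b)
    (g : Y ⟶ X) (h' : (g ≫ d) ≫ triMap p (tri q r) = assocApp (g ≫ b)) :
    g ≫ assocAct b d h = assocAct (g ≫ b) (g ≫ d) h' :=
  comp_dirMk_eq _ _ _ _ _ _ rfl (comp_dirMk_eq _ _ _ _ _ _ (Category.assoc ..).symm
    (Category.assoc ..).symm (by simp only [Category.assoc]) _ _)
    (by simp only [Category.assoc]) _ _

end

/-- The associator `(p ◁ q) ◁ r ⟶ p ◁ (q ◁ r)`. -/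
noncomputable def associatorHom (p q r : Poly E) : tri (tri p q) r ⟶ tri p (tri q r) :=
  Hom.ofElem {
    app := fun b => assocApp b
    comp_app := fun g b => comp_assocApp g b
    act := fun b d h => assocAct b d h
    comp_act := fun g b d h => comp_assocAct b d h g _
    act_map := fun _ _ _ => dirMk_map .. }

section

variable {X : E} (p q r : Poly E)

theorem associatorHom_app (b : X ⟶ triPos (tri p q) r) :
    (associatorHom p q r).app b = assocApp b :=
  Hom.ofElem_app ..

theorem associatorHom_act (b : X ⟶ triPos (tri p q) r) (d : X ⟶ triDir p (tri q r))
    (h : d ≫ triMap p (tri q r) = (associatorHom p q r).app b) :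
    (associatorHom p q r).act b d h = assocAct b d (h.trans (associatorHom_app p q r b)) :=
  Hom.ofElem_act ..

end

section

variable {p q r : Poly E} {X Y : E}

theorem assocInv_aux₁ (b : X ⟶ triPos p (tri q r)) :
    pullback.snd (b ≫ triProj p (tri q r)) p.map ≫ p.map =
      (pullback.fst (b ≫ triProj p (tri q r)) p.map ≫ b) ≫ triProj p (tri q r) := by
  rw [← pullback.condition, Category.assoc]

/-- The position of `p ◁ q` underlying a position of `p ◁ (q ◁ r)`. -/
noncomputable def assocInvFst (b : X ⟶ triPos p (tri q r)) : X ⟶ triPos p q :=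
  posMk (b ≫ triProj p (tri q r))
    (evalAt (pullback.fst _ _ ≫ b) (pullback.snd _ _) (assocInv_aux₁ b) ≫ triProj q r)

theorem assocInvFst_proj (b : X ⟶ triPos p (tri q r)) :
    assocInvFst b ≫ triProj p q = b ≫ triProj p (tri q r) :=
  posMk_proj ..

theorem evalAt_assocInvFst (b : X ⟶ triPos p (tri q r)) (y : X ⟶ p.dir)
    (h : y ≫ p.map = assocInvFst b ≫ triProj p q) : evalAt (assocInvFst b) y h =
      evalAt b y (h.trans (assocInvFst_proj b)) ≫ triProj q r :=
  posMk_eval _ _ _ _ _ fun h' => (Category.assoc ..).symm.trans (congrArg (· ≫ triProj q r)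
    (comp_evalAt_eq (q := tri q r) _ _ _ _ (by rw [pullback.lift_fst_assoc, Category.id_comp])
      (pullback.lift_snd ..) _))

theorem comp_assocInvFst (g : Y ⟶ X) (b : X ⟶ triPos p (tri q r)) :
    g ≫ assocInvFst b = assocInvFst (g ≫ b) :=
  comp_posMk_eq _ _ _ _ _ (Category.assoc ..).symm
    ((Category.assoc ..).symm.trans (congrArg (· ≫ triProj q r)
      (comp_evalAt_eq (q := tri q r) _ _ _ _ (by simp [bc]) (bc_snd ..) _)))

theorem assocInv_aux₂ (b : X ⟶ triPos p (tri q r)) (d : X ⟶ triDir p q)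
    (h : d ≫ triMap p q = assocInvFst b) :
    (d ≫ triFst p q) ≫ p.map = b ≫ triProj p (tri q r) :=
  (fst_map h).trans (assocInvFst_proj b)

theorem assocInv_aux₃ (b : X ⟶ triPos p (tri q r)) (d : X ⟶ triDir p q)
    (h : d ≫ triMap p q = assocInvFst b) : (d ≫ triSnd p q) ≫ q.map =
      evalAt b (d ≫ triFst p q) (assocInv_aux₂ b d h) ≫ triProj q r :=
  (snd_map h).trans (evalAt_assocInvFst ..)

/-- The value at `d` of the position of `(p ◁ q) ◁ r` corresponding to `b`. -/
noncomputable def assocInvEval (b : X ⟶ triPos p (tri q r)) (d : X ⟶ triDir p q)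
    (h : d ≫ triMap p q = assocInvFst b) : X ⟶ r.pos :=
  evalAt (evalAt b (d ≫ triFst p q) (assocInv_aux₂ b d h)) (d ≫ triSnd p q)
    (assocInv_aux₃ b d h)

theorem comp_assocInvEval_eq (g : Y ⟶ X) (b : X ⟶ triPos p (tri q r)) (d : X ⟶ triDir p q)
    (h : d ≫ triMap p q = assocInvFst b) {b' : Y ⟶ triPos p (tri q r)} {d' : Y ⟶ triDir p q}
    (hb : g ≫ b = b') (hd : g ≫ d = d') (h' : d' ≫ triMap p q = assocInvFst b') :
    g ≫ assocInvEval b d h = assocInvEval b' d' h' := by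
  subst hb hd
  exact comp_evalAt_eq _ _ _ _ (comp_evalAt_eq (q := tri q r) _ _ _ _ rfl
    (Category.assoc ..).symm _) (Category.assoc ..).symm _

theorem assocInv_aux₄ (b : X ⟶ triPos p (tri q r)) :
    pullback.snd (assocInvFst b) (triMap p q) ≫ triMap p q =
      assocInvFst (pullback.fst (assocInvFst b) (triMap p q) ≫ b) := by
  rw [← pullback.condition, comp_assocInvFst]

/-- The action of the inverse of the associator on positions. -/
noncomputable def assocInvApp (b : X ⟶ triPos p (tri q r)) : X ⟶ triPos (tri p q) r :=
  posMk (p := tri p q) (assocInvFst b)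
    (assocInvEval (pullback.fst (assocInvFst b) (triMap p q) ≫ b) (pullback.snd _ _)
      (assocInv_aux₄ b))

theorem assocInvApp_proj (b : X ⟶ triPos p (tri q r)) :
    assocInvApp b ≫ triProj (tri p q) r = assocInvFst b :=
  posMk_proj (p := tri p q) ..

theorem evalAt_assocInvApp (b : X ⟶ triPos p (tri q r)) (d : X ⟶ triDir p q)
    (h : d ≫ triMap p q = assocInvApp b ≫ triProj (tri p q) r) :
    evalAt (p := tri p q) (assocInvApp b) d h =
      assocInvEval b d (h.trans (assocInvApp_proj b)) :=
  posMk_eval (p := tri p q) _ _ _ _ _ fun _ => comp_assocInvEval_eq _ _ _ _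
    ((pullback.lift_fst_assoc ..).trans (Category.id_comp b)) (pullback.lift_snd ..) _

theorem comp_assocInvApp (g : Y ⟶ X) (b : X ⟶ triPos p (tri q r)) :
    g ≫ assocInvApp b = assocInvApp (g ≫ b) :=
  comp_posMk_eq (p := tri p q) _ _ _ _ _ (comp_assocInvFst ..)
    (comp_assocInvEval_eq _ _ _ _ (by simp [bc]) (bc_snd ..) _)

theorem assocInv_aux₅ (b : X ⟶ triPos p (tri q r)) (d : X ⟶ triDir (tri p q) r)
    (h : d ≫ triMap (tri p q) r = assocInvApp b) :
    (d ≫ triFst (tri p q) r) ≫ triMap p q = assocInvFst b :=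
  (fst_map h).trans (assocInvApp_proj b)

theorem assocInv_aux₆ (b : X ⟶ triPos p (tri q r)) (d : X ⟶ triDir (tri p q) r)
    (h : d ≫ triMap (tri p q) r = assocInvApp b) : (d ≫ triSnd (tri p q) r) ≫ r.map =
      evalAt (evalAt b ((d ≫ triFst (tri p q) r) ≫ triFst p q)
        (assocInv_aux₂ b _ (assocInv_aux₅ b d h))) ((d ≫ triFst (tri p q) r) ≫ triSnd p q)
        (assocInv_aux₃ b _ (assocInv_aux₅ b d h)) :=
  (snd_map h).trans (evalAt_assocInvApp ..)

/-- The action of the inverse of the associator on directions. -/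
noncomputable def assocInvAct (b : X ⟶ triPos p (tri q r)) (d : X ⟶ triDir (tri p q) r)
    (h : d ≫ triMap (tri p q) r = assocInvApp b) : X ⟶ triDir p (tri q r) :=
  dirMk (q := tri q r) b ((d ≫ triFst (tri p q) r) ≫ triFst p q)
    (assocInv_aux₂ b _ (assocInv_aux₅ b d h))
    (dirMk (evalAt b ((d ≫ triFst (tri p q) r) ≫ triFst p q)
        (assocInv_aux₂ b _ (assocInv_aux₅ b d h))) ((d ≫ triFst (tri p q) r) ≫ triSnd p q)
        (assocInv_aux₃ b _ (assocInv_aux₅ b d h)) (d ≫ triSnd (tri p q) r)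
        (assocInv_aux₆ b d h)) (dirMk_map ..)

theorem comp_assocInvAct (b : X ⟶ triPos p (tri q r)) (d : X ⟶ triDir (tri p q) r)
    (h : d ≫ triMap (tri p q) r = assocInvApp b) (g : Y ⟶ X)
    (h' : (g ≫ d) ≫ triMap (tri p q) r = assocInvApp (g ≫ b)) :
    g ≫ assocInvAct b d h = assocInvAct (g ≫ b) (g ≫ d) h' :=
  comp_dirMk_eq (q := tri q r) _ _ _ _ _ _ rfl (by simp only [Category.assoc])
    (comp_dirMk_eq _ _ _ _ _ _
      (comp_evalAt_eq (q := tri q r) _ _ _ _ rfl (by simp only [Category.assoc]) _)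
      (by simp only [Category.assoc]) (by simp only [Category.assoc]) _ _) _ _

end

/-- The inverse of the associator. -/
noncomputable def associatorInv (p q r : Poly E) : tri p (tri q r) ⟶ tri (tri p q) r :=
  Hom.ofElem {
    app := fun b => assocInvApp b
    comp_app := fun g b => comp_assocInvApp g b
    act := fun b d h => assocInvAct b d h
    comp_act := fun g b d h => comp_assocInvAct b d h g _
    act_map := fun _ _ _ => dirMk_map .. }

section

variable {X : E} (p q r : Poly E)

theorem associatorInv_app (b : X ⟶ triPos p (tri q r)) :
    (associatorInv p q r).app b = assocInvApp b :=
  Hom.ofElem_app ..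

theorem associatorInv_act (b : X ⟶ triPos p (tri q r)) (d : X ⟶ triDir (tri p q) r)
    (h : d ≫ triMap (tri p q) r = (associatorInv p q r).app b) :
    (associatorInv p q r).act b d h = assocInvAct b d (h.trans (associatorInv_app p q r b)) :=
  Hom.ofElem_act ..

variable {p q r}

theorem evalAt_left {b b' : X ⟶ triPos p q} (hb : b = b') {y : X ⟶ p.dir}
    {h : y ≫ p.map = b ≫ triProj p q} : evalAt b y h = evalAt b' y (hb ▸ h) := by
  subst hb
  rfl

theorem evalAt_right {b : X ⟶ triPos p q} {y y' : X ⟶ p.dir} (hy : y = y')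
    {h : y ≫ p.map = b ≫ triProj p q} : evalAt b y h = evalAt b y' (hy ▸ h) := by
  subst hy
  rfl

/-- A variant of `pos_ext` for naturally given positions. -/
theorem pos_ext_nat {Y : E} (F G : ∀ {X : E}, (X ⟶ Y) → (X ⟶ triPos p q))
    (hF : ∀ {X X' : E} (g : X' ⟶ X) (x : X ⟶ Y), g ≫ F x = F (g ≫ x))
    (hG : ∀ {X X' : E} (g : X' ⟶ X) (x : X ⟶ Y), g ≫ G x = G (g ≫ x))
    (h : ∀ {X : E} (x : X ⟶ Y), F x ≫ triProj p q = G x ≫ triProj p q)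
    (h' : ∀ {X : E} (x : X ⟶ Y) (y : X ⟶ p.dir) (hy : y ≫ p.map = F x ≫ triProj p q)
      (hy' : y ≫ p.map = G x ≫ triProj p q), evalAt (F x) y hy = evalAt (G x) y hy')
    {X : E} (x : X ⟶ Y) : F x = G x :=
  pos_ext (h x) fun w y _ _ => (evalAt_left (hF w x)).trans
    ((h' (w ≫ x) y _ _).trans (evalAt_left (hG w x)).symm)

/-- A variant of `pos_ext_nat` for positions of `p ◁ (q ◁ r)`. -/
theorem pos_ext_nat₂ {Y : E} (F G : ∀ {X : E}, (X ⟶ Y) → (X ⟶ triPos p (tri q r)))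
    (hF : ∀ {X X' : E} (g : X' ⟶ X) (x : X ⟶ Y), g ≫ F x = F (g ≫ x))
    (hG : ∀ {X X' : E} (g : X' ⟶ X) (x : X ⟶ Y), g ≫ G x = G (g ≫ x))
    (h : ∀ {X : E} (x : X ⟶ Y), F x ≫ triProj p (tri q r) = G x ≫ triProj p (tri q r))
    (h₁ : ∀ {X : E} (x : X ⟶ Y) (y : X ⟶ p.dir) (hy : y ≫ p.map = F x ≫ triProj p (tri q r))
      (hy' : y ≫ p.map = G x ≫ triProj p (tri q r)),
      evalAt (F x) y hy ≫ triProj q r = evalAt (G x) y hy' ≫ triProj q r)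
    (h₂ : ∀ {X : E} (x : X ⟶ Y) (y : X ⟶ p.dir) (hy : y ≫ p.map = F x ≫ triProj p (tri q r))
      (hy' : y ≫ p.map = G x ≫ triProj p (tri q r)) (z : X ⟶ q.dir)
      (hz : z ≫ q.map = evalAt (F x) y hy ≫ triProj q r)
      (hz' : z ≫ q.map = evalAt (G x) y hy' ≫ triProj q r),
      evalAt (p := q) (q := r) (evalAt (F x) y hy) z hz =
        evalAt (p := q) (q := r) (evalAt (G x) y hy') z hz')
    {X : E} (x : X ⟶ Y) : F x = G x :=
  pos_ext_nat (q := tri q r) F G hF hG h (fun {X} x y hy hy' => pos_ext (h₁ x y hy hy')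
    fun {W} w z hz hz' => by
      have a : (w ≫ y) ≫ p.map = F (w ≫ x) ≫ triProj p (tri q r) := by
        rw [Category.assoc, hy, ← Category.assoc, hF]
      have a' : (w ≫ y) ≫ p.map = G (w ≫ x) ≫ triProj p (tri q r) := by
        rw [Category.assoc, hy', ← Category.assoc, hG]
      have e := comp_evalAt_eq (q := tri q r) w (F x) y hy (hF w x) rfl a
      have e' := comp_evalAt_eq (q := tri q r) w (G x) y hy' (hG w x) rfl a'
      exact (evalAt_left e).trans ((h₂ (w ≫ x) (w ≫ y) a a' z _ _).trans (evalAt_left e').symm)) x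

theorem dirMk_eta (b : X ⟶ triPos p q) (d : X ⟶ triDir p q) (hd : d ≫ triMap p q = b) (h h') :
    dirMk b (d ≫ triFst p q) h (d ≫ triSnd p q) h' = d :=
  dir_ext (by rw [dirMk_map, hd]) (dirMk_fst ..) (dirMk_snd ..)

theorem dirMk_eq {b : X ⟶ triPos p q} {y : X ⟶ p.dir} {h : y ≫ p.map = b ≫ triProj p q}
    {z : X ⟶ q.dir} {h' : z ≫ q.map = evalAt b y h} {d : X ⟶ triDir p q}
    (hd : d ≫ triMap p q = b) (hy : y = d ≫ triFst p q) (hz : z = d ≫ triSnd p q) :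
    dirMk b y h z h' = d :=
  dir_ext (by rw [dirMk_map, hd]) (by rw [dirMk_fst, hy]) (by rw [dirMk_snd, hz])

end

section

variable (p q r : Poly E) {X : E}

theorem assocInvApp_assocApp (b : X ⟶ triPos (tri p q) r) : assocInvApp (assocApp b) = b := by
  have e : ∀ {X : E} (b : X ⟶ triPos (tri p q) r),
      assocInvFst (assocApp b) = b ≫ triProj (tri p q) r :=
    pos_ext_nat (fun b => assocInvFst (assocApp b)) (fun b => b ≫ triProj (tri p q) r)
      (fun g b => by rw [comp_assocInvFst, comp_assocApp]) (fun g b => (Category.assoc ..).symm)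
      (fun b => by rw [assocInvFst_proj, assocApp_proj])
      (fun b y h h' => by rw [evalAt_assocInvFst, evalAt_assocApp, assocEval_proj])
  refine pos_ext_nat (p := tri p q) (fun b => assocInvApp (assocApp b)) (fun b => b)
    (fun g b => by rw [comp_assocInvApp, comp_assocApp]) (fun g b => rfl)
    (fun b => by rw [assocInvApp_proj, e]) (fun b y h h' => ?_) b
  rw [evalAt_assocInvApp]
  exact (evalAt_left (evalAt_assocApp ..)).trans ((evalAt_assocEval ..).trans
    (evalAt_right (p := tri p q) (dirMk_eta _ _ (h.trans ((assocInvApp_proj _).trans (e b))) _ _)))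

theorem assocApp_assocInvApp (b : X ⟶ triPos p (tri q r)) : assocApp (assocInvApp b) = b :=
  pos_ext_nat₂ (fun b => assocApp (assocInvApp b)) (fun b => b)
    (fun g b => by rw [comp_assocApp, comp_assocInvApp]) (fun g b => rfl)
    (fun b => by rw [assocApp_proj, assocInvApp_proj, assocInvFst_proj])
    (fun b y h h' => by
      rw [evalAt_assocApp, assocEval_proj, evalAt_left (assocInvApp_proj b), evalAt_assocInvFst])
    (fun b y h h' z hz hz' => (evalAt_left (evalAt_assocApp ..)).trans
      ((evalAt_assocEval ..).trans ((evalAt_assocInvApp ..).trans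
        (evalAt_congr (evalAt_right (dirMk_fst ..)) (dirMk_snd ..))))) b

theorem associatorHom_inv : associatorHom p q r ≫ associatorInv p q r = 𝟙 _ :=
  hom_ext (fun b => by
      rw [comp_app, associatorHom_app, associatorInv_app, assocInvApp_assocApp, id_app])
    (fun b d h h' => by
      rw [comp_act, id_act, associatorHom_act]
      have h₁ : d ≫ triMap (tri p q) r = b := h'.trans (id_app _ b)
      have h₂ : (d ≫ triFst (tri p q) r) ≫ triMap p q = b ≫ triProj (tri p q) r := fst_map h₁
      have e := associatorInv_act p q r ((associatorHom p q r).app b) d (h.trans (comp_app ..))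
      have e₁ := (congrArg (· ≫ triFst p (tri q r)) e).trans (dirMk_fst ..)
      have e₂ := (congrArg (· ≫ triSnd p (tri q r)) e).trans (dirMk_snd ..)
      refine dirMk_eq h₁ (dirMk_eq h₂ e₁ ?_) ?_
      · rw [e₂, dirMk_fst]
      · rw [e₂, dirMk_snd])

theorem associatorInv_hom : associatorInv p q r ≫ associatorHom p q r = 𝟙 _ :=
  hom_ext (fun b => by
      rw [comp_app, associatorInv_app, associatorHom_app, assocApp_assocInvApp, id_app])
    (fun b d h h' => by
      rw [comp_act, id_act, associatorInv_act]
      have h₁ : d ≫ triMap p (tri q r) = b := h'.trans (id_app _ b)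
      have e := associatorHom_act p q r ((associatorInv p q r).app b) d (h.trans (comp_app ..))
      have e₁ := (congrArg (· ≫ triFst (tri p q) r) e).trans (dirMk_fst ..)
      have e₂ := (congrArg (· ≫ triSnd (tri p q) r) e).trans (dirMk_snd ..)
      have e₃ := (congrArg (· ≫ triFst p q) e₁).trans (dirMk_fst ..)
      have e₄ := (congrArg (· ≫ triSnd p q) e₁).trans (dirMk_snd ..)
      refine dirMk_eq (q := tri q r) h₁ e₃ (dirMk_eq ?_ e₄ e₂)
      exact (snd_map h₁).trans (evalAt_right e₃.symm))

/-- The associator. -/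
noncomputable def associator : tri (tri p q) r ≅ tri p (tri q r) where
  hom := associatorHom p q r
  inv := associatorInv p q r
  hom_inv_id := associatorHom_inv p q r
  inv_hom_id := associatorInv_hom p q r

end

/-- The left unitor. -/
noncomputable def leftUnitor (p : Poly E) : tri (unit E) p ≅ p where
  hom := leftUnitorHom p
  inv := leftUnitorInv p
  hom_inv_id := hom_ext (fun b => by
      rw [comp_app, id_app]
      exact pos_ext_nat (fun b => (leftUnitorInv p).app ((leftUnitorHom p).app b)) (fun b => b)
        (fun g b => by simp only [Hom.comp_app]) (fun g b => rfl) (fun b => terminal.hom_ext ..)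
        (fun b y h h' => (evalAt_leftUnitorInv_app ..).trans ((leftUnitorHom_app ..).trans
          (evalAt_right (terminal.hom_ext ..)))) b)
    (fun b d h h' => by
      rw [comp_act, id_act, leftUnitorHom_act]
      exact dirMk_eq (h'.trans (id_app _ b)) (terminal.hom_ext ..) (leftUnitorInv_act ..))
  inv_hom_id := hom_ext (fun x => by
      rw [comp_app, id_app, leftUnitorHom_app, evalAt_leftUnitorInv_app])
    (fun x d h h' => by
      rw [comp_act, id_act, leftUnitorInv_act]
      exact (congrArg (· ≫ triSnd (unit E) p) (leftUnitorHom_act ..)).trans (dirMk_snd ..))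

/-- The right unitor. -/
noncomputable def rightUnitor (p : Poly E) : tri p (unit E) ≅ p where
  hom := rightUnitorHom p
  inv := rightUnitorInv p
  hom_inv_id := hom_ext (fun b => by
      rw [comp_app, id_app]
      exact pos_ext (by rw [rightUnitorInv_app_proj, rightUnitorHom_app])
        (fun _ _ _ _ => terminal.hom_ext ..))
    (fun b d h h' => by
      rw [comp_act, id_act, rightUnitorHom_act]
      exact dirMk_eq (h'.trans (id_app _ b)) (rightUnitorInv_act ..) (terminal.hom_ext ..))
  inv_hom_id := hom_ext (fun x => by
      rw [comp_app, id_app, rightUnitorHom_app, rightUnitorInv_app_proj])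
    (fun x d h h' => by
      rw [comp_act, id_act, rightUnitorInv_act]
      exact (congrArg (· ≫ triFst p (unit E)) (rightUnitorHom_act ..)).trans (dirMk_fst ..))

/-! ### The monoidal category of polynomials -/

section

variable {p q r : Poly E} {X Y : E}

theorem triHom_proj {p' q' : Poly E} (φ : p ⟶ p') (ψ : q ⟶ q') (b : X ⟶ triPos p q) :
    (triHom φ ψ).app b ≫ triProj p' q' = φ.app (b ≫ triProj p q) := by
  rw [triHom_app, triApp_proj]

theorem evalAt_triHom {p' q' : Poly E} (φ : p ⟶ p') (ψ : q ⟶ q') (b : X ⟶ triPos p q)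
    (y : X ⟶ p'.dir) (h : y ≫ p'.map = (triHom φ ψ).app b ≫ triProj p' q') :
    evalAt ((triHom φ ψ).app b) y h =
      ψ.app (evalAt b (φ.act (b ≫ triProj p q) y (h.trans (triHom_proj φ ψ b)))
        (Hom.act_map ..)) :=
  (evalAt_left (triHom_app ..)).trans (evalAt_triApp ..)

theorem assoc_proj (b : X ⟶ triPos (tri p q) r) :
    (associatorHom p q r).app b ≫ triProj p (tri q r) =
      (b ≫ triProj (tri p q) r) ≫ triProj p q := by
  rw [associatorHom_app, assocApp_proj]

theorem evalAt_assoc (b : X ⟶ triPos (tri p q) r) (y : X ⟶ p.dir)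
    (h : y ≫ p.map = (associatorHom p q r).app b ≫ triProj p (tri q r)) :
    evalAt ((associatorHom p q r).app b) y h = assocEval b y (h.trans (assoc_proj b)) :=
  (evalAt_left (associatorHom_app ..)).trans (evalAt_assocApp ..)

theorem evalAt_assoc_proj (b : X ⟶ triPos (tri p q) r) (y : X ⟶ p.dir)
    (h : y ≫ p.map = (associatorHom p q r).app b ≫ triProj p (tri q r)) :
    evalAt ((associatorHom p q r).app b) y h ≫ triProj q r =
      evalAt (b ≫ triProj (tri p q) r) y (h.trans (assoc_proj b)) := by
  rw [evalAt_assoc, assocEval_proj]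

theorem evalAt_evalAt_assoc (b : X ⟶ triPos (tri p q) r) (y : X ⟶ p.dir)
    (h : y ≫ p.map = (associatorHom p q r).app b ≫ triProj p (tri q r)) (z : X ⟶ q.dir)
    (h' : z ≫ q.map = evalAt ((associatorHom p q r).app b) y h ≫ triProj q r) :
    evalAt (p := q) (q := r) (evalAt ((associatorHom p q r).app b) y h) z h' =
      evalAt b (dirMk (b ≫ triProj (tri p q) r) y (h.trans (assoc_proj b)) z
        (h'.trans (evalAt_assoc_proj b y h))) (dirMk_map ..) :=
  (evalAt_left (evalAt_assoc ..)).trans (evalAt_assocEval ..)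

/-- A variant of `hom_tri_ext` for morphisms into `p ◁ (q ◁ r)`. -/
theorem hom_tri_ext₂ {s : Poly E} {φ ψ : s ⟶ tri p (tri q r)}
    (h : ∀ {X : E} (x : X ⟶ s.pos), φ.app x ≫ triProj p (tri q r) = ψ.app x ≫ triProj p (tri q r))
    (h₁ : ∀ {X : E} (x : X ⟶ s.pos) (y : X ⟶ p.dir)
      (hy : y ≫ p.map = φ.app x ≫ triProj p (tri q r))
      (hy' : y ≫ p.map = ψ.app x ≫ triProj p (tri q r)),
      evalAt (φ.app x) y hy ≫ triProj q r = evalAt (ψ.app x) y hy' ≫ triProj q r)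
    (h₂ : ∀ {X : E} (x : X ⟶ s.pos) (y : X ⟶ p.dir)
      (hy : y ≫ p.map = φ.app x ≫ triProj p (tri q r))
      (hy' : y ≫ p.map = ψ.app x ≫ triProj p (tri q r)) (z : X ⟶ q.dir)
      (hz : z ≫ q.map = evalAt (φ.app x) y hy ≫ triProj q r)
      (hz' : z ≫ q.map = evalAt (ψ.app x) y hy' ≫ triProj q r),
      evalAt (p := q) (q := r) (evalAt (φ.app x) y hy) z hz =
        evalAt (p := q) (q := r) (evalAt (ψ.app x) y hy') z hz')
    (h'' : ∀ {X : E} (x : X ⟶ s.pos) (d : X ⟶ triDir p (tri q r))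
      (hφ : d ≫ triMap p (tri q r) = φ.app x) (hψ : d ≫ triMap p (tri q r) = ψ.app x),
      φ.act x d hφ = ψ.act x d hψ) : φ = ψ :=
  hom_ext (fun x => pos_ext_nat₂ (fun x => φ.app x) (fun x => ψ.app x) (Hom.comp_app φ)
    (Hom.comp_app ψ) h h₁ h₂ x) h''

theorem app_congr {φ : p ⟶ q} {x x' : X ⟶ p.pos} (h : x = x') : φ.app x = φ.app x' :=
  congrArg φ.app h

theorem triHom_fst {p' q' : Poly E} (φ : p ⟶ p') (ψ : q ⟶ q') (b : X ⟶ triPos p q)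
    (d : X ⟶ triDir p' q') (h : d ≫ triMap p' q' = (triHom φ ψ).app b) :
    (triHom φ ψ).act b d h ≫ triFst p q = φ.act (b ≫ triProj p q) (d ≫ triFst p' q')
      ((fst_map h).trans (triHom_proj φ ψ b)) := by
  rw [triHom_act, dirMk_fst]

theorem triHom_snd {p' q' : Poly E} (φ : p ⟶ p') (ψ : q ⟶ q') (b : X ⟶ triPos p q)
    (d : X ⟶ triDir p' q') (h : d ≫ triMap p' q' = (triHom φ ψ).app b) :
    (triHom φ ψ).act b d h ≫ triSnd p q =
      ψ.act (evalAt b (φ.act (b ≫ triProj p q) (d ≫ triFst p' q')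
        ((fst_map h).trans (triHom_proj φ ψ b))) (Hom.act_map ..)) (d ≫ triSnd p' q')
        ((snd_map h).trans (evalAt_triHom ..)) := by
  rw [triHom_act, dirMk_snd]

section

variable (b : X ⟶ triPos (tri p q) r) (d : X ⟶ triDir p (tri q r))
  (h : d ≫ triMap p (tri q r) = (associatorHom p q r).app b)

theorem assoc_fst_fst : ((associatorHom p q r).act b d h ≫ triFst (tri p q) r) ≫ triFst p q =
    d ≫ triFst p (tri q r) := by
  rw [associatorHom_act, assocAct, dirMk_fst, dirMk_fst]

theorem assoc_fst_snd : ((associatorHom p q r).act b d h ≫ triFst (tri p q) r) ≫ triSnd p q =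
    (d ≫ triSnd p (tri q r)) ≫ triFst q r := by
  rw [associatorHom_act, assocAct, dirMk_fst, dirMk_snd]

theorem assoc_snd : (associatorHom p q r).act b d h ≫ triSnd (tri p q) r =
    (d ≫ triSnd p (tri q r)) ≫ triSnd q r := by
  rw [associatorHom_act, assocAct, dirMk_snd]

end

theorem dir_ext₂ {b : X ⟶ triPos (tri p q) r} {d d' : X ⟶ triDir (tri p q) r}
    (h : d ≫ triMap (tri p q) r = b) (h' : d' ≫ triMap (tri p q) r = b)
    (h₁ : (d ≫ triFst (tri p q) r) ≫ triFst p q = (d' ≫ triFst (tri p q) r) ≫ triFst p q)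
    (h₂ : (d ≫ triFst (tri p q) r) ≫ triSnd p q = (d' ≫ triFst (tri p q) r) ≫ triSnd p q)
    (h₃ : d ≫ triSnd (tri p q) r = d' ≫ triSnd (tri p q) r) : d = d' :=
  dir_ext (h.trans h'.symm) (dir_ext ((fst_map h).trans (fst_map h').symm) h₁ h₂) h₃

theorem triHom_id (p q : Poly E) : triHom (𝟙 p) (𝟙 q) = 𝟙 (tri p q) :=
  hom_tri_ext (fun b => by rw [triHom_proj, id_app, id_app])
    (fun b y h h' => by
      rw [evalAt_triHom, id_app]
      exact evalAt_congr (id_app _ b).symm (id_act ..))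
    (fun b d h h' => dir_ext ((Hom.act_map ..).trans (Hom.act_map ..).symm)
      (by rw [triHom_fst, id_act, id_act]) (by rw [triHom_snd, id_act, id_act]))

theorem triHom_comp {p' q' p'' q'' : Poly E} (φ : p ⟶ p') (ψ : q ⟶ q') (φ' : p' ⟶ p'')
    (ψ' : q' ⟶ q'') : triHom φ ψ ≫ triHom φ' ψ' = triHom (φ ≫ φ') (ψ ≫ ψ') :=
  hom_tri_ext (fun b => by rw [comp_app, triHom_proj, triHom_proj, triHom_proj, comp_app])
    (fun b y h h' => by
      refine (evalAt_left (comp_app ..)).trans ?_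
      rw [evalAt_triHom, evalAt_triHom, evalAt_triHom]
      refine Eq.trans ?_ (comp_app ..).symm
      refine app_congr (app_congr (evalAt_right ?_))
      rw [comp_act]
      exact Hom.act_congr _ rfl (Hom.act_congr _ (triHom_proj ..) rfl))
    (fun b d h h' => by
      have e : ((triHom φ ψ ≫ triHom φ' ψ').act b d h) ≫ triFst p q =
          (triHom (φ ≫ φ') (ψ ≫ ψ')).act b d h' ≫ triFst p q := by
        rw [comp_act, triHom_fst φ ψ, triHom_fst (φ ≫ φ'), comp_act]
        exact Hom.act_congr _ rfl ((triHom_fst ..).trans (Hom.act_congr _ (triHom_proj ..) rfl))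
      refine dir_ext ((Hom.act_map ..).trans (Hom.act_map ..).symm) e ?_
      rw [comp_act, triHom_fst φ ψ, triHom_fst (φ ≫ φ')] at e
      rw [comp_act, triHom_snd φ ψ, triHom_snd (φ ≫ φ'), comp_act ψ]
      refine Hom.act_congr _ (evalAt_right e) ((triHom_snd ..).trans (Hom.act_congr _ ?_ rfl))
      refine (evalAt_triHom ..).trans (app_congr (evalAt_right ?_))
      exact Eq.trans (Hom.act_congr _ rfl (triHom_fst ..).symm) e)

theorem associator_naturality {p' q' r' : Poly E} (φ : p ⟶ p') (ψ : q ⟶ q') (χ : r ⟶ r') :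
    triHom (triHom φ ψ) χ ≫ associatorHom p' q' r' =
      associatorHom p q r ≫ triHom φ (triHom ψ χ) :=
  hom_tri_ext₂
    (fun b => by
      rw [comp_app, comp_app, assoc_proj, triHom_proj, triHom_proj, triHom_proj, assoc_proj])
    (fun b y h h' => by
      refine (congrArg (· ≫ _) (evalAt_left (comp_app ..))).trans ((evalAt_assoc_proj ..).trans
        (Eq.trans ?_ (congrArg (· ≫ _) (evalAt_left (comp_app ..))).symm))
      rw [evalAt_left (triHom_proj ..), evalAt_triHom, evalAt_triHom, triHom_proj ψ χ]
      refine app_congr (Eq.trans ?_ (evalAt_assoc_proj ..).symm)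
      exact evalAt_right (Hom.act_congr _ (assoc_proj b).symm rfl))
    (fun b y h h' z hz hz' => by
      refine (evalAt_left (evalAt_left (comp_app ..))).trans ((evalAt_evalAt_assoc ..).trans
        (Eq.trans ?_ (evalAt_left (evalAt_left (comp_app ..))).symm))
      rw [evalAt_triHom (p' := tri p' q')]
      refine Eq.trans ?_ ((evalAt_left (evalAt_triHom φ (triHom ψ χ) ..)).trans
        (evalAt_triHom ψ χ ..)).symm
      refine app_congr (Eq.trans ?_ (evalAt_evalAt_assoc ..).symm)
      refine evalAt_right (p := tri p q) (dirMk_eq (Hom.act_map ..) ?_ ?_).symm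
      · exact ((triHom_fst ..).trans (Hom.act_congr _ (assoc_proj b).symm (dirMk_fst ..))).symm
      · refine ((triHom_snd ..).trans (Hom.act_congr _ (Eq.trans ?_ (evalAt_assoc_proj ..).symm)
          (dirMk_snd ..))).symm
        exact evalAt_right (Hom.act_congr _ (assoc_proj b).symm (dirMk_fst ..)))
    (fun b d h h' => by
      refine dir_ext₂ (Hom.act_map ..) (Hom.act_map ..) ?_ ?_ ?_
      · rw [comp_act, comp_act, triHom_fst (triHom φ ψ), triHom_fst φ ψ, assoc_fst_fst (p := p) (q := q) (r := r),
          triHom_fst φ (triHom ψ χ)]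
        exact Hom.act_congr _ (assoc_proj b).symm (assoc_fst_fst ..)
      · rw [comp_act, comp_act, triHom_fst (triHom φ ψ), triHom_snd φ ψ, assoc_fst_snd (p := p) (q := q) (r := r),
          triHom_snd φ (triHom ψ χ), triHom_fst ψ χ]
        refine Hom.act_congr _ (Eq.trans ?_ (evalAt_assoc_proj ..).symm) (assoc_fst_snd ..)
        exact evalAt_right (Hom.act_congr _ (assoc_proj b).symm (assoc_fst_fst ..))
      · rw [comp_act, comp_act, triHom_snd (triHom φ ψ), assoc_snd (p := p) (q := q) (r := r), triHom_snd φ (triHom ψ χ),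
          triHom_snd ψ χ]
        refine Hom.act_congr _ (Eq.trans ?_ (evalAt_evalAt_assoc ..).symm) (assoc_snd ..)
        refine evalAt_right (p := tri p q) (dirMk_eq (Hom.act_map ..) ?_ ?_).symm
        · exact ((triHom_fst ..).trans
            (Hom.act_congr _ (assoc_proj b).symm (assoc_fst_fst ..))).symm
        · refine ((triHom_snd ..).trans (Hom.act_congr _ (Eq.trans ?_ (evalAt_assoc_proj ..).symm)
            (assoc_fst_snd ..))).symm
          exact evalAt_right (Hom.act_congr _ (assoc_proj b).symm (assoc_fst_fst ..)))

theorem leftUnitor_naturality (φ : p ⟶ q) :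
    triHom (𝟙 (unit E)) φ ≫ leftUnitorHom q = leftUnitorHom p ≫ φ :=
  hom_ext
    (fun b => by
      rw [comp_app, comp_app, leftUnitorHom_app, leftUnitorHom_app, evalAt_triHom]
      exact app_congr (evalAt_right (terminal.hom_ext ..)))
    (fun b d h h' => by
      have e := leftUnitorHom_act q ((triHom (𝟙 (unit E)) φ).app b) d (h.trans (comp_app ..))
      have e₂ := (congrArg (· ≫ triSnd (unit E) q) e).trans (dirMk_snd ..)
      rw [comp_act, comp_act, leftUnitorHom_act p, triHom_act]
      exact dirMk_congr rfl (terminal.hom_ext ..) (Hom.act_congr _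
        ((evalAt_right (terminal.hom_ext ..)).trans (leftUnitorHom_app ..).symm) e₂))

theorem rightUnitor_naturality (φ : p ⟶ q) :
    triHom φ (𝟙 (unit E)) ≫ rightUnitorHom q = rightUnitorHom p ≫ φ :=
  hom_ext
    (fun b => by
      rw [comp_app, comp_app, rightUnitorHom_app, rightUnitorHom_app, triHom_proj])
    (fun b d h h' => by
      have e := rightUnitorHom_act q ((triHom φ (𝟙 (unit E))).app b) d (h.trans (comp_app ..))
      have e₁ := (congrArg (· ≫ triFst q (unit E)) e).trans (dirMk_fst ..)
      rw [comp_act, comp_act, rightUnitorHom_act p, triHom_act]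
      exact dirMk_congr rfl (Hom.act_congr _ (rightUnitorHom_app ..).symm e₁)
        (terminal.hom_ext ..))

theorem triangle (p q : Poly E) :
    associatorHom p (unit E) q ≫ triHom (𝟙 p) (leftUnitorHom q) =
      triHom (rightUnitorHom p) (𝟙 q) :=
  hom_tri_ext
    (fun b => by
      rw [comp_app, triHom_proj, triHom_proj, rightUnitorHom_app, id_app, assoc_proj])
    (fun b y h h' => by
      refine (evalAt_left (comp_app ..)).trans ?_
      rw [evalAt_triHom, evalAt_triHom, leftUnitorHom_app, id_app q]
      refine (evalAt_evalAt_assoc ..).trans (evalAt_right (p := tri p (unit E)) ?_)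
      rw [rightUnitorHom_act]
      exact dirMk_congr rfl (id_act ..) (terminal.hom_ext ..))
    (fun b d h h' => by
      refine dir_ext₂ (Hom.act_map ..) (Hom.act_map ..) ?_ (terminal.hom_ext ..) ?_
      · rw [comp_act, assoc_fst_fst, triHom_fst, triHom_fst, id_act, rightUnitorHom_act, dirMk_fst]
      · rw [comp_act, assoc_snd, triHom_snd, triHom_snd, id_act q, leftUnitorHom_act, dirMk_snd])

/-- A variant of `hom_tri_ext₂` for morphisms into `p ◁ (q ◁ (r ◁ s))`. -/
theorem hom_tri_ext₃ {s t : Poly E} {φ ψ : t ⟶ tri p (tri q (tri r s))}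
    (h : ∀ {X : E} (x : X ⟶ t.pos),
      φ.app x ≫ triProj p (tri q (tri r s)) = ψ.app x ≫ triProj p (tri q (tri r s)))
    (h₁ : ∀ {X : E} (x : X ⟶ t.pos) (y : X ⟶ p.dir)
      (hy : y ≫ p.map = φ.app x ≫ triProj p (tri q (tri r s)))
      (hy' : y ≫ p.map = ψ.app x ≫ triProj p (tri q (tri r s))),
      evalAt (φ.app x) y hy ≫ triProj q (tri r s) = evalAt (ψ.app x) y hy' ≫ triProj q (tri r s))
    (h₂ : ∀ {X : E} (x : X ⟶ t.pos) (y : X ⟶ p.dir)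
      (hy : y ≫ p.map = φ.app x ≫ triProj p (tri q (tri r s)))
      (hy' : y ≫ p.map = ψ.app x ≫ triProj p (tri q (tri r s))) (z : X ⟶ q.dir)
      (hz : z ≫ q.map = evalAt (φ.app x) y hy ≫ triProj q (tri r s))
      (hz' : z ≫ q.map = evalAt (ψ.app x) y hy' ≫ triProj q (tri r s)),
      evalAt (p := q) (q := tri r s) (evalAt (φ.app x) y hy) z hz ≫ triProj r s =
        evalAt (p := q) (q := tri r s) (evalAt (ψ.app x) y hy') z hz' ≫ triProj r s)
    (h₃ : ∀ {X : E} (x : X ⟶ t.pos) (y : X ⟶ p.dir)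
      (hy : y ≫ p.map = φ.app x ≫ triProj p (tri q (tri r s)))
      (hy' : y ≫ p.map = ψ.app x ≫ triProj p (tri q (tri r s))) (z : X ⟶ q.dir)
      (hz : z ≫ q.map = evalAt (φ.app x) y hy ≫ triProj q (tri r s))
      (hz' : z ≫ q.map = evalAt (ψ.app x) y hy' ≫ triProj q (tri r s)) (w : X ⟶ r.dir)
      (hw : w ≫ r.map =
        evalAt (p := q) (q := tri r s) (evalAt (φ.app x) y hy) z hz ≫ triProj r s)
      (hw' : w ≫ r.map =
        evalAt (p := q) (q := tri r s) (evalAt (ψ.app x) y hy') z hz' ≫ triProj r s),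
      evalAt (p := r) (q := s)
          (evalAt (p := q) (q := tri r s) (evalAt (φ.app x) y hy) z hz) w hw =
        evalAt (p := r) (q := s)
          (evalAt (p := q) (q := tri r s) (evalAt (ψ.app x) y hy') z hz') w hw')
    (h'' : ∀ {X : E} (x : X ⟶ t.pos) (d : X ⟶ triDir p (tri q (tri r s)))
      (hφ : d ≫ triMap p (tri q (tri r s)) = φ.app x)
      (hψ : d ≫ triMap p (tri q (tri r s)) = ψ.app x), φ.act x d hφ = ψ.act x d hψ) : φ = ψ :=
  hom_tri_ext₂ (r := tri r s) h h₁ (fun {X} x y hy hy' z hz hz' =>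
    pos_ext (p := r) (q := s) (h₂ x y hy hy' z hz hz') fun {W} g w hw hw' => by
      have A : ∀ χ : t ⟶ tri p (tri q (tri r s)),
          y ≫ p.map = χ.app x ≫ triProj p (tri q (tri r s)) →
          (g ≫ y) ≫ p.map = χ.app (g ≫ x) ≫ triProj p (tri q (tri r s)) := fun χ hy => by
        rw [Category.assoc, hy, ← Category.assoc, Hom.comp_app]
      have e (χ : t ⟶ tri p (tri q (tri r s))) (hy) := comp_evalAt_eq (q := tri q (tri r s))
        g (χ.app x) y hy (Hom.comp_app χ g x) rfl (A χ hy)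
      have B (χ : t ⟶ tri p (tri q (tri r s))) (hy)
          (hz : z ≫ q.map = evalAt (χ.app x) y hy ≫ triProj q (tri r s)) :
          (g ≫ z) ≫ q.map = evalAt (χ.app (g ≫ x)) (g ≫ y) (A χ hy) ≫ triProj q (tri r s) := by
        rw [Category.assoc, hz, ← Category.assoc, e]
      have f (χ : t ⟶ tri p (tri q (tri r s))) (hy) (hz) := comp_evalAt_eq (p := q)
        (q := tri r s) g (evalAt (χ.app x) y hy) z hz (e χ hy) rfl (B χ hy hz)
      exact (evalAt_left (f φ hy hz)).trans ((h₃ (g ≫ x) (g ≫ y) (A φ hy) (A ψ hy') (g ≫ z)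
        (B φ hy hz) (B ψ hy' hz') w _ _).trans (evalAt_left (f ψ hy' hz')).symm)) h''

theorem dir_ext₃ {s : Poly E} {b : X ⟶ triPos (tri (tri p q) r) s}
    {d d' : X ⟶ triDir (tri (tri p q) r) s}
    (h : d ≫ triMap (tri (tri p q) r) s = b) (h' : d' ≫ triMap (tri (tri p q) r) s = b)
    (h₁ : ((d ≫ triFst (tri (tri p q) r) s) ≫ triFst (tri p q) r) ≫ triFst p q =
      ((d' ≫ triFst (tri (tri p q) r) s) ≫ triFst (tri p q) r) ≫ triFst p q)
    (h₂ : ((d ≫ triFst (tri (tri p q) r) s) ≫ triFst (tri p q) r) ≫ triSnd p q =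
      ((d' ≫ triFst (tri (tri p q) r) s) ≫ triFst (tri p q) r) ≫ triSnd p q)
    (h₃ : (d ≫ triFst (tri (tri p q) r) s) ≫ triSnd (tri p q) r =
      (d' ≫ triFst (tri (tri p q) r) s) ≫ triSnd (tri p q) r)
    (h₄ : d ≫ triSnd (tri (tri p q) r) s = d' ≫ triSnd (tri (tri p q) r) s) : d = d' :=
  dir_ext (h.trans h'.symm) (dir_ext₂ (fst_map h) (fst_map h') h₁ h₂ h₃) h₄

theorem pentagon (p q r s : Poly E) :
    triHom (associatorHom p q r) (𝟙 s) ≫ associatorHom p (tri q r) s ≫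
        triHom (𝟙 p) (associatorHom q r s) =
      associatorHom (tri p q) r s ≫ associatorHom p q (tri r s) :=
  hom_tri_ext₃
    (fun b => by
      rw [comp_app, comp_app, comp_app, triHom_proj, id_app, assoc_proj, triHom_proj, assoc_proj,
        assoc_proj, assoc_proj])
    (fun b y h h' => by
      have L := (comp_app (triHom (associatorHom p q r) (𝟙 s)) (associatorHom p (tri q r) s ≫
        triHom (𝟙 p) (associatorHom q r s)) b).trans (comp_app ..)
      refine (congrArg (· ≫ _) ((evalAt_left L).trans (evalAt_triHom ..))).trans ?_
      refine (assoc_proj _).trans ((congrArg (· ≫ _) (evalAt_assoc_proj ..)).trans ?_)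
      refine (congrArg (· ≫ _) (evalAt_left (triHom_proj ..))).trans
        ((evalAt_assoc_proj ..).trans ((evalAt_right (id_act ..)).trans ?_))
      exact ((congrArg (· ≫ _) (evalAt_left (comp_app ..))).trans ((evalAt_assoc_proj ..).trans
        (evalAt_left (assoc_proj _)))).symm)
    (fun b y h h' z hz hz' => by
      have L := (comp_app (triHom (associatorHom p q r) (𝟙 s)) (associatorHom p (tri q r) s ≫
        triHom (𝟙 p) (associatorHom q r s)) b).trans (comp_app ..)
      refine (congrArg (· ≫ _) (evalAt_left ((evalAt_left L).trans (evalAt_triHom ..)))).trans ?_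
      refine (evalAt_assoc_proj ..).trans ((evalAt_left (evalAt_assoc_proj ..)).trans ?_)
      refine (evalAt_left (evalAt_left (triHom_proj ..))).trans ((evalAt_evalAt_assoc ..).trans ?_)
      refine Eq.trans ?_ ((congrArg (· ≫ _) ((evalAt_left (evalAt_left (comp_app ..))).trans
        (evalAt_evalAt_assoc ..))).trans (evalAt_assoc_proj ..)).symm
      exact evalAt_right (p := tri p q) (dirMk_congr (assoc_proj _).symm (id_act ..) rfl))
    (fun b y h h' z hz hz' w hw hw' => by
      have L := (comp_app (triHom (associatorHom p q r) (𝟙 s)) (associatorHom p (tri q r) s ≫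
        triHom (𝟙 p) (associatorHom q r s)) b).trans (comp_app ..)
      refine (evalAt_left (evalAt_left ((evalAt_left L).trans (evalAt_triHom ..)))).trans ?_
      refine (evalAt_evalAt_assoc ..).trans ((evalAt_evalAt_assoc ..).trans
        ((evalAt_triHom ..).trans ((id_app ..).trans ?_)))
      refine Eq.trans ?_ ((evalAt_left ((evalAt_left (evalAt_left (comp_app ..))).trans
        (evalAt_evalAt_assoc ..))).trans (evalAt_evalAt_assoc ..)).symm
      refine evalAt_right (p := tri (tri p q) r) (dirMk_eq (Hom.act_map ..)
        (dirMk_eq ((fst_map (Hom.act_map ..)).trans (assoc_proj _).symm) ?_ ?_) ?_).symm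
      · exact ((assoc_fst_fst ..).trans ((dirMk_fst ..).trans (id_act ..))).symm
      · exact ((assoc_fst_snd ..).trans ((congrArg (· ≫ _) (dirMk_snd ..)).trans
          (dirMk_fst ..))).symm
      · exact ((assoc_snd ..).trans ((congrArg (· ≫ _) (dirMk_snd ..)).trans
          (dirMk_snd ..))).symm)
    (fun b d h h' => by
      refine dir_ext₃ (Hom.act_map ..) (Hom.act_map ..) ?_ ?_ ?_ ?_
      · rw [comp_act, triHom_fst, assoc_fst_fst, comp_act, assoc_fst_fst, triHom_fst, id_act,
          comp_act, assoc_fst_fst, assoc_fst_fst]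
      · rw [comp_act, triHom_fst, assoc_fst_snd, comp_act, assoc_fst_snd, triHom_snd,
          assoc_fst_fst, comp_act, assoc_fst_fst, assoc_fst_snd]
      · rw [comp_act, triHom_fst, assoc_snd, comp_act, assoc_fst_snd, triHom_snd,
          assoc_fst_snd, comp_act, assoc_fst_snd, assoc_snd]
      · rw [comp_act, triHom_snd, id_act, comp_act, assoc_snd, triHom_snd, assoc_snd,
          comp_act, assoc_snd, assoc_snd])

end

/-- The monoidal structure on polynomials given by the composition product `◁` with unit `y`. -/
noncomputable instance : MonoidalCategoryStruct (Poly E) where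
  tensorObj := tri
  whiskerLeft p _ _ ψ := triHom (𝟙 p) ψ
  whiskerRight φ q := triHom φ (𝟙 q)
  tensorHom := triHom
  tensorUnit := unit E
  associator := associator
  leftUnitor := leftUnitor
  rightUnitor := rightUnitor

noncomputable instance : MonoidalCategory (Poly E) :=
  MonoidalCategory.ofTensorHom
    (id_tensorHom_id := triHom_id)
    (id_tensorHom := fun _ _ _ _ => rfl)
    (tensorHom_id := fun _ _ => rfl)
    (tensorHom_comp_tensorHom := triHom_comp)
    (associator_naturality := associator_naturality)
    (leftUnitor_naturality := leftUnitor_naturality)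
    (rightUnitor_naturality := rightUnitor_naturality)
    (pentagon := pentagon)
    (triangle := triangle)

end Poly

/-- The structure of an internal category in `E` on a morphism `s : C₁ ⟶ C₀`, which is the source
map: a target map, identities and composition of composable pairs (in diagrammatic order), subject
to the usual laws. -/
structure InternalCategory {C₁ C₀ : E} (s : C₁ ⟶ C₀) where
  /-- the target map -/
  t : C₁ ⟶ C₀
  /-- the identity map -/
  i : C₀ ⟶ C₁
  /-- the composition map, on pairs `(f, g)` with `t f = s g` -/
  k : pullback t s ⟶ C₁
  i_s : i ≫ s = 𝟙 C₀
  i_t : i ≫ t = 𝟙 C₀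
  k_s : k ≫ s = pullback.fst t s ≫ s
  k_t : k ≫ t = pullback.snd t s ≫ t
  id_comp : pullback.lift (s ≫ i) (𝟙 C₁)
    (by rw [Category.assoc, i_t, Category.comp_id, Category.id_comp]) ≫ k = 𝟙 C₁
  comp_id : pullback.lift (𝟙 C₁) (t ≫ i)
    (by rw [Category.assoc, i_s, Category.comp_id, Category.id_comp]) ≫ k = 𝟙 C₁
  /-- associativity on the object of triples `((f, g), h)` with `t f = s g` and `t g = s h` -/
  assoc :
    pullback.lift (pullback.fst (pullback.snd t s ≫ t) s ≫ k)
        (pullback.snd (pullback.snd t s ≫ t) s)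
        (by rw [Category.assoc, k_t, pullback.condition]) ≫ k =
      pullback.lift (pullback.fst (pullback.snd t s ≫ t) s ≫ pullback.fst t s)
        (pullback.lift (pullback.fst (pullback.snd t s ≫ t) s ≫ pullback.snd t s)
          (pullback.snd (pullback.snd t s ≫ t) s)
          (by rw [Category.assoc, pullback.condition]) ≫ k)
        (by rw [Category.assoc, Category.assoc, k_s, pullback.lift_fst_assoc, pullback.condition,
          Category.assoc]) ≫ k

end PolyIn

namespace PolyIn

/-! By Yoneda, everything can be said with generalised elements. A position of `c ◁ c` is a position
`x` of `c` together with a natural rule assigning a position of `c` to every direction over `x`; a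
direction over it is a pair `(f, g)` with `f` over `x` and `g` over the value of the rule at `f`.
Hence a morphism `δ : c ⟶ c ◁ c` that keeps the underlying position (`PreservesPos`) amounts to a
target `tgt f` for each direction `f`, and a composite `mul f g`, over the same position as `f`, for
each pair in which `tgt f` is the source of `g`. A morphism `ε : c ⟶ y` amounts to a direction `idn
ε x` over each position `x`.

The laws are then translated one at a time. The right counit law forces `PreservesPos` on positions
and says `f · id = f` on directions (`preservesPos_of_comul_counit`, `comul_counit_iff`). The left
counit law says that identities have the right target and that `id · f = f` (`counit_comul_iff`).
Coassociativity says that `f · g` has the target of `g` and that composition is associative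
(`coassoc_iff`). The remaining axioms, on the sources of identities and composites, hold because
`ε♯` and `δ♯` are morphisms over `C`.

Naturality makes `tgt`, `idn` and `mul` precomposition formulas for morphisms `t`, `i` and `k`,
found by evaluating at universal elements. Conversely `(t, i, k)` defines `ε` and `δ` (`counitOf`,
`comulOf`), whose targets, identities and composites are the given ones. Both structures are
determined by these data (`counit_ext`, `comul_ext`, `InternalCategory.ext_of`), so the two passages
are mutually inverse. -/

/-- The domain of `k` depends on `t`, so the composition maps cannot be equated directly. Comparing
them on composable pairs, with a proof of composability for each target map, avoids transport; the
pair of pullback projections suffices. -/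
theorem InternalCategory.ext_of {E : Type u} [Category.{v} E] [HasFiniteLimits E] {C₁ C₀ : E}
    {s : C₁ ⟶ C₀} {K L : InternalCategory s} (ht : K.t = L.t) (hi : K.i = L.i)
    (hk : ∀ {X : E} (f g : X ⟶ C₁) (h : f ≫ K.t = g ≫ s) (h' : f ≫ L.t = g ≫ s),
      pullback.lift f g h ≫ K.k = pullback.lift f g h' ≫ L.k) : K = L := by
  obtain ⟨t, i, k, _, _, _, _, _, _, _⟩ := K
  obtain ⟨t', i', k', _, _, _, _, _, _, _⟩ := L
  dsimp only at ht hi hk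
  subst ht hi
  obtain rfl : k = k' := by
    have e : pullback.lift (pullback.fst t s) (pullback.snd t s) pullback.condition = 𝟙 _ := by
      apply pullback.hom_ext <;> simp
    simpa only [e, Category.id_comp] using hk (pullback.fst t s) (pullback.snd t s)
      pullback.condition pullback.condition
  rfl

namespace Poly

variable {E : Type u} [Category.{v} E] [HasFiniteLimits E] {c : Poly E} {X Y : E}

/-! ### Identities, targets and composites as generalised elements -/

/-- The identity at a generalised position `x` given by a morphism `ε : c ⟶ y`. -/
noncomputable def idn (ε : c ⟶ unit E) (x : X ⟶ c.pos) : X ⟶ c.dir :=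
  Hom.act ε x (terminal.from X) (terminal.hom_ext ..)

theorem idn_map (ε : c ⟶ unit E) (x : X ⟶ c.pos) : idn ε x ≫ c.map = x :=
  Hom.act_map ..

theorem comp_idn (ε : c ⟶ unit E) (g : Y ⟶ X) (x : X ⟶ c.pos) : g ≫ idn ε x = idn ε (g ≫ x) :=
  (Hom.comp_act ..).trans (Hom.act_congr _ rfl (terminal.hom_ext ..))

theorem act_congr_hom {p q : Poly E} {φ ψ : p ⟶ q} (H : φ = ψ) {x : X ⟶ p.pos} {d : X ⟶ q.dir}
    {h : d ≫ q.map = φ.app x} : φ.act x d h = ψ.act x d (H ▸ h) := by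
  subst H
  rfl

/-- The direction argument lies in a terminal object, so `ε♯` depends on the position alone. -/
theorem act_unit (ε : c ⟶ unit E) (x : X ⟶ c.pos) (d : X ⟶ ⊤_ E)
    (h : d ≫ (unit E).map = Hom.app ε x) : Hom.act ε x d h = idn ε x :=
  Hom.act_congr _ rfl (terminal.hom_ext ..)

/-- The morphism `δ : c ⟶ c ◁ c` preserves the underlying position of `c`. -/
def PreservesPos (δ : c ⟶ tri c c) : Prop :=
  ∀ (X : E) (x : X ⟶ c.pos), δ.app x ≫ triProj c c = x

section

variable {δ : c ⟶ tri c c} (hδ : PreservesPos δ)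

/-- The target of a generalised direction `f` with respect to `δ : c ⟶ c ◁ c`. -/
noncomputable def tgt (f : X ⟶ c.dir) : X ⟶ c.pos :=
  evalAt (δ.app (f ≫ c.map)) f (hδ _ _).symm

theorem comp_tgt (g : Y ⟶ X) (f : X ⟶ c.dir) : g ≫ tgt hδ f = tgt hδ (g ≫ f) :=
  comp_evalAt_eq _ _ _ _ ((Hom.comp_app ..).trans (app_congr (Category.assoc ..).symm)) rfl _

/-- Since `δ` keeps the underlying position, a direction at which `δ x` can be evaluated lies over
`x` itself; the value therefore depends on `f` only. -/
theorem evalAt_eq_tgt {x : X ⟶ c.pos} {f : X ⟶ c.dir} (h : f ≫ c.map = δ.app x ≫ triProj c c) :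
    evalAt (δ.app x) f h = tgt hδ f :=
  evalAt_left (app_congr ((hδ _ x).symm.trans h.symm))

/-- The composite of the generalised directions `f` and `g` with respect to `δ : c ⟶ c ◁ c`. -/
noncomputable def mul (f g : X ⟶ c.dir) (h : tgt hδ f = g ≫ c.map) : X ⟶ c.dir :=
  δ.act (f ≫ c.map) (dirMk (δ.app (f ≫ c.map)) f (hδ _ _).symm g h.symm) (dirMk_map ..)

theorem mul_map (f g : X ⟶ c.dir) (h : tgt hδ f = g ≫ c.map) :
    mul hδ f g h ≫ c.map = f ≫ c.map :=
  Hom.act_map ..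

theorem mul_congr {f g f' g' : X ⟶ c.dir} (hf : f = f') (hg : g = g')
    {h : tgt hδ f = g ≫ c.map} {h' : tgt hδ f' = g' ≫ c.map} :
    mul hδ f g h = mul hδ f' g' h' := by
  subst hf hg
  rfl

theorem comp_mul (u : Y ⟶ X) (f g : X ⟶ c.dir) (h : tgt hδ f = g ≫ c.map) :
    u ≫ mul hδ f g h = mul hδ (u ≫ f) (u ≫ g) (by rw [← comp_tgt, h, Category.assoc]) :=
  (Hom.comp_act ..).trans (Hom.act_congr _ (Category.assoc ..).symm
    (comp_dirMk_eq _ _ _ _ _ _ ((Hom.comp_app ..).trans (app_congr (Category.assoc ..).symm))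
      rfl rfl _ _))

theorem fst_map_eq (hδ : PreservesPos δ) {x : X ⟶ c.pos} {d : X ⟶ triDir c c}
    (h : d ≫ triMap c c = δ.app x) : (d ≫ triFst c c) ≫ c.map = x :=
  (fst_map h).trans (hδ _ x)

theorem tgt_fst {x : X ⟶ c.pos} {d : X ⟶ triDir c c} (h : d ≫ triMap c c = δ.app x) :
    tgt hδ (d ≫ triFst c c) = (d ≫ triSnd c c) ≫ c.map :=
  ((snd_map h).trans (evalAt_eq_tgt hδ _)).symm

/-- A direction over `δ x` is recovered from its two components, and `x` is the source of the first.
So `mul` carries all the information in `δ♯`. -/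
theorem act_eq_mul {x : X ⟶ c.pos} {d : X ⟶ triDir c c} (h : d ≫ triMap c c = δ.app x) :
    δ.act x d h = mul hδ (d ≫ triFst c c) (d ≫ triSnd c c) (tgt_fst hδ h) :=
  Hom.act_congr _ (fst_map_eq hδ h).symm
    (dirMk_eq (h.trans (app_congr (fst_map_eq hδ h).symm)) rfl rfl).symm

/-- The form used below: a direction produced by `triHom` or a unitor is known through its
components, and rewriting them inside `mul` would disturb its proof argument. -/
theorem act_eq_mul_of_eq {x : X ⟶ c.pos} {d : X ⟶ triDir c c} (h : d ≫ triMap c c = δ.app x)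
    {f g : X ⟶ c.dir} (hf : d ≫ triFst c c = f) (hg : d ≫ triSnd c c = g) :
    δ.act x d h = mul hδ f g (by subst hf hg; exact tgt_fst hδ h) := by
  subst hf hg
  exact act_eq_mul hδ h

theorem act_dirMk_eq_mul {x : X ⟶ c.pos} {b : X ⟶ triPos c c} (f : X ⟶ c.dir)
    (h : f ≫ c.map = b ≫ triProj c c) (g : X ⟶ c.dir) (h' : g ≫ c.map = evalAt b f h)
    (h'' : dirMk b f h g h' ≫ triMap c c = δ.app x) (h₃ : tgt hδ f = g ≫ c.map) :
    δ.act x (dirMk b f h g h') h'' = mul hδ f g h₃ :=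
  act_eq_mul_of_eq hδ h'' (dirMk_fst ..) (dirMk_snd ..)

/-! ### The two counit laws -/

/-- The right unitor acts on positions as the projection `triProj`, and `𝟙 ◁ ε` leaves that
projection unchanged. The position component of the right counit law is thus exactly the claim. -/
theorem preservesPos_of_comul_counit {ε : c ⟶ unit E}
    (H : δ ≫ triHom (𝟙 c) ε ≫ rightUnitorHom c = 𝟙 c) : PreservesPos δ := fun _ x => by
  have := congrArg (fun φ : c ⟶ c => φ.app x) H
  simpa only [comp_app, rightUnitorHom_app, triHom_proj, id_app] using this

/-- Running `f` backwards through the composite, the unitor pairs it with the unique direction of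
`y`, then `𝟙 ◁ ε` replaces the latter by the identity at `tgt f`, and finally `δ♯` composes. The law
on positions is already contained in `hδ`. -/
theorem comul_counit_iff (ε : c ⟶ unit E) :
    δ ≫ triHom (𝟙 c) ε ≫ rightUnitorHom c = 𝟙 c ↔
      ∀ {X : E} (f : X ⟶ c.dir),
        mul hδ f (idn ε (tgt hδ f)) (idn_map ..).symm = f := by
  have key {X : E} (x : X ⟶ c.pos) (f : X ⟶ c.dir)
      (h : f ≫ c.map = Hom.app (δ ≫ triHom (𝟙 c) ε ≫ rightUnitorHom c) x) :
      (δ ≫ triHom (𝟙 c) ε ≫ rightUnitorHom c).act x f h =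
        mul hδ f (idn ε (tgt hδ f)) (idn_map ..).symm := by
    have h₀ : f ≫ c.map = (rightUnitorHom c).app ((triHom (𝟙 c) ε).app (δ.app x)) := by
      rw [h, comp_app, comp_app]
    have e := rightUnitorHom_act c ((triHom (𝟙 c) ε).app (δ.app x)) f h₀
    have e₁ := (congrArg (· ≫ triFst c (unit E)) e).trans (dirMk_fst ..)
    rw [comp_act]
    refine act_eq_mul_of_eq hδ _ ?_ ?_
    · rw [comp_act, triHom_fst, id_act, e₁]
    · rw [comp_act, triHom_snd, act_unit, evalAt_eq_tgt hδ, id_act, e₁]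
  constructor
  · intro H X f
    have h : f ≫ c.map = Hom.app (δ ≫ triHom (𝟙 c) ε ≫ rightUnitorHom c) (f ≫ c.map) := by
      rw [H, id_app]
    rw [← key (f ≫ c.map) f h]
    exact (act_congr_hom H).trans (id_act ..)
  · intro H
    refine hom_ext (fun x => ?_) fun x f h h' => ?_
    · rw [comp_app, comp_app, rightUnitorHom_app, triHom_proj, id_app, id_app, hδ]
    · rw [key, H, id_act]

/-- Here the position component has content: the left unitor evaluates, so it says that the identity
at `x` has target `x`. Only then is the composite in the direction component defined, whence the
existential over the first law. -/
theorem counit_comul_iff (ε : c ⟶ unit E) :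
    δ ≫ triHom ε (𝟙 c) ≫ leftUnitorHom c = 𝟙 c ↔
      ∃ h : ∀ {X : E} (x : X ⟶ c.pos), tgt hδ (idn ε x) = x, ∀ {X : E} (f : X ⟶ c.dir),
        mul hδ (idn ε (f ≫ c.map)) f (h _) = f := by
  have key₀ {X : E} (x : X ⟶ c.pos) :
      Hom.app (δ ≫ triHom ε (𝟙 c) ≫ leftUnitorHom c) x = tgt hδ (idn ε x) := by
    rw [comp_app, comp_app, leftUnitorHom_app, evalAt_triHom, id_app]
    refine (evalAt_eq_tgt hδ _).trans ?_
    rw [act_unit, hδ]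
  have key (H : ∀ {X : E} (x : X ⟶ c.pos), tgt hδ (idn ε x) = x) {X : E}
      (x : X ⟶ c.pos) (f : X ⟶ c.dir)
      (h : f ≫ c.map = Hom.app (δ ≫ triHom ε (𝟙 c) ≫ leftUnitorHom c) x) :
      (δ ≫ triHom ε (𝟙 c) ≫ leftUnitorHom c).act x f h =
        mul hδ (idn ε (f ≫ c.map)) f (H _) := by
    have h₀ : f ≫ c.map = (leftUnitorHom c).app ((triHom ε (𝟙 c)).app (δ.app x)) := by
      rw [h, comp_app, comp_app]
    -- The target law identifies `x` with the source of `f`, so the identity produced at `x` is the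
    -- one at that source.
    have hx : f ≫ c.map = x := by rw [h, key₀, H]
    have e := leftUnitorHom_act c ((triHom ε (𝟙 c)).app (δ.app x)) f h₀
    have e₁ := (congrArg (· ≫ triSnd (unit E) c) e).trans (dirMk_snd ..)
    rw [comp_act]
    refine act_eq_mul_of_eq hδ _ ?_ ?_
    · rw [comp_act, triHom_fst, act_unit, hδ, hx]
    · rw [comp_act, triHom_snd, id_act, e₁]
  constructor
  · intro H
    have H₀ {X : E} (x : X ⟶ c.pos) : tgt hδ (idn ε x) = x := by rw [← key₀, H, id_app]
    refine ⟨H₀, fun {X} f => ?_⟩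
    have h : f ≫ c.map = Hom.app (δ ≫ triHom ε (𝟙 c) ≫ leftUnitorHom c) (f ≫ c.map) := by
      rw [H, id_app]
    rw [← key H₀ (f ≫ c.map) f h]
    exact (act_congr_hom H).trans (id_act ..)
  · rintro ⟨H₀, H⟩
    refine hom_ext (fun x => ?_) fun x f h h' => ?_
    · rw [key₀, H₀, id_app]
    · rw [key H₀, H, id_act]

/-! ### Coassociativity -/

/-- A position of `c ◁ (c ◁ c)` is determined by its base, the projected value at a direction `y`,
and the iterated value at `y` and then `z`. The first two agree on both sides automatically; the
third is `tgt z` on the left and `tgt (y · z)` on the right. On a triple of directions `(f, g, k)`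
the two sides act as `f · (g · k)` and `(f · g) · k`. -/
theorem coassoc_iff :
    δ ≫ triHom (𝟙 c) δ = δ ≫ triHom δ (𝟙 c) ≫ associatorHom c c c ↔
      ∃ h : ∀ {X : E} (f g : X ⟶ c.dir) (hfg : tgt hδ f = g ≫ c.map),
          tgt hδ (mul hδ f g hfg) = tgt hδ g,
        ∀ {X : E} (f g k : X ⟶ c.dir) (hfg : tgt hδ f = g ≫ c.map) (hgk : tgt hδ g = k ≫ c.map),
          mul hδ (mul hδ f g hfg) k ((h f g hfg).trans hgk) =
            mul hδ f (mul hδ g k hgk) (hfg.trans (mul_map ..).symm) := by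
  have projL {X : E} (x : X ⟶ c.pos) :
      Hom.app (δ ≫ triHom (𝟙 c) δ) x ≫ triProj c (tri c c) = x := by
    rw [comp_app, triHom_proj, id_app, hδ]
  have projR {X : E} (x : X ⟶ c.pos) :
      Hom.app (δ ≫ triHom δ (𝟙 c) ≫ associatorHom c c c) x ≫ triProj c (tri c c) = x := by
    rw [comp_app, comp_app, assoc_proj, triHom_proj, hδ, hδ]
  -- On the left the value at `y` is a whole position of `c ◁ c`, namely `δ (tgt y)`. On the right
  -- the associator gives access only to its projection (`evR`) and its own values (`evR₂`).
  have evL {X : E} (x : X ⟶ c.pos) (y : X ⟶ c.dir)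
      (hy : y ≫ c.map = Hom.app (δ ≫ triHom (𝟙 c) δ) x ≫ triProj c (tri c c)) :
      evalAt (Hom.app (δ ≫ triHom (𝟙 c) δ) x) y hy = δ.app (tgt hδ y) := by
    refine (evalAt_left (comp_app ..)).trans ((evalAt_triHom ..).trans (app_congr ?_))
    exact (evalAt_right (id_act ..)).trans (evalAt_eq_tgt ..)
  have evR {X : E} (x : X ⟶ c.pos) (y : X ⟶ c.dir)
      (hy : y ≫ c.map = Hom.app (δ ≫ triHom δ (𝟙 c) ≫ associatorHom c c c) x ≫
        triProj c (tri c c)) :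
      evalAt (Hom.app (δ ≫ triHom δ (𝟙 c) ≫ associatorHom c c c) x) y hy ≫ triProj c c =
        tgt hδ y := by
    refine (congrArg (· ≫ triProj c c) (evalAt_left ((comp_app ..).trans (comp_app ..)))).trans
      ((evalAt_assoc_proj ..).trans ((evalAt_left (triHom_proj ..)).trans (evalAt_eq_tgt ..)))
  have evR₂ {X : E} (x : X ⟶ c.pos) (y : X ⟶ c.dir)
      (hy : y ≫ c.map = Hom.app (δ ≫ triHom δ (𝟙 c) ≫ associatorHom c c c) x ≫
        triProj c (tri c c)) (z : X ⟶ c.dir) (hz : z ≫ c.map =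
        evalAt (Hom.app (δ ≫ triHom δ (𝟙 c) ≫ associatorHom c c c) x) y hy ≫ triProj c c)
      (hyz : tgt hδ y = z ≫ c.map) :
      evalAt (p := c) (q := c)
        (evalAt (Hom.app (δ ≫ triHom δ (𝟙 c) ≫ associatorHom c c c) x) y hy) z hz =
        tgt hδ (mul hδ y z hyz) := by
    refine (evalAt_left (evalAt_left ((comp_app ..).trans (comp_app ..)))).trans
      ((evalAt_evalAt_assoc ..).trans ((evalAt_triHom ..).trans ((id_app ..).trans ?_)))
    exact (evalAt_right (act_dirMk_eq_mul hδ _ _ _ _ _ hyz)).trans (evalAt_eq_tgt ..)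
  have actL {X : E} (x : X ⟶ c.pos) (d : X ⟶ triDir c (tri c c))
      (h : d ≫ triMap c (tri c c) = Hom.app (δ ≫ triHom (𝟙 c) δ) x) (f g k : X ⟶ c.dir)
      (hf : d ≫ triFst c (tri c c) = f) (hg : (d ≫ triSnd c (tri c c)) ≫ triFst c c = g)
      (hk : (d ≫ triSnd c (tri c c)) ≫ triSnd c c = k)
      (hfg : tgt hδ f = g ≫ c.map) (hgk : tgt hδ g = k ≫ c.map) :
      Hom.act (δ ≫ triHom (𝟙 c) δ) x d h =
        mul hδ f (mul hδ g k hgk) (hfg.trans (mul_map ..).symm) := by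
    rw [comp_act]
    refine act_eq_mul_of_eq hδ _ ?_ ?_
    · rw [triHom_fst, id_act, hf]
    · rw [triHom_snd]
      exact act_eq_mul_of_eq hδ _ hg hk
  have actR {X : E} (x : X ⟶ c.pos) (d : X ⟶ triDir c (tri c c))
      (h : d ≫ triMap c (tri c c) = Hom.app (δ ≫ triHom δ (𝟙 c) ≫ associatorHom c c c) x)
      (f g k : X ⟶ c.dir)
      (hf : d ≫ triFst c (tri c c) = f) (hg : (d ≫ triSnd c (tri c c)) ≫ triFst c c = g)
      (hk : (d ≫ triSnd c (tri c c)) ≫ triSnd c c = k)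
      (hfg : tgt hδ f = g ≫ c.map) (hgk : tgt hδ (mul hδ f g hfg) = k ≫ c.map) :
      Hom.act (δ ≫ triHom δ (𝟙 c) ≫ associatorHom c c c) x d h =
        mul hδ (mul hδ f g hfg) k hgk := by
    rw [comp_act]
    refine act_eq_mul_of_eq hδ _ ?_ ?_
    · rw [comp_act, triHom_fst]
      exact act_eq_mul_of_eq hδ _ ((assoc_fst_fst ..).trans hf) ((assoc_fst_snd ..).trans hg)
    · rw [comp_act, triHom_snd, id_act, assoc_snd, hk]
  constructor
  · intro H
    have H₀ {X : E} (f g : X ⟶ c.dir) (hfg : tgt hδ f = g ≫ c.map) :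
        tgt hδ (mul hδ f g hfg) = tgt hδ g := by
      have hf := (projR (f ≫ c.map)).symm
      rw [← evR₂ (f ≫ c.map) f hf g (hfg.symm.trans (evR ..).symm)]
      have hf' := (projL (f ≫ c.map)).symm
      -- Evaluating both sides at `f` yields `δ (tgt f)`; evaluating that once more, at `g`, gives
      -- `tgt g`.
      have e := (evalAt_left (q := tri c c) (congrArg (fun φ => Hom.app φ (f ≫ c.map)) H)
        (h := hf')).symm.trans (evL _ _ _)
      exact (evalAt_left e).trans (evalAt_eq_tgt ..)
    refine ⟨H₀, fun {X} f g k hfg hgk => ?_⟩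
    have hf : f ≫ c.map = Hom.app (δ ≫ triHom (𝟙 c) δ) (f ≫ c.map) ≫ triProj c (tri c c) :=
      (projL (f ≫ c.map)).symm
    -- The pair `(g, k)` as a direction over `δ (tgt f)`. Paired with `f` it becomes a direction of
    -- `c ◁ (c ◁ c)` encoding the composable triple, on which the two sides are compared.
    let d₀ : X ⟶ triDir c c := dirMk (δ.app (tgt hδ f)) g
      (hfg.symm.trans (hδ _ _).symm) k (hgk.symm.trans (evalAt_eq_tgt ..).symm)
    have hd₀ : d₀ ≫ triMap c c = evalAt (Hom.app (δ ≫ triHom (𝟙 c) δ) (f ≫ c.map)) f hf :=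
      (dirMk_map ..).trans (evL ..).symm
    have h := dirMk_map (q := tri c c) _ f hf d₀ hd₀
    have e₁ := dirMk_fst (q := tri c c) _ f hf d₀ hd₀
    have e₂ := dirMk_snd (q := tri c c) _ f hf d₀ hd₀
    have e₃ := (congrArg (· ≫ triFst c c) e₂).trans (dirMk_fst ..)
    have e₄ := (congrArg (· ≫ triSnd c c) e₂).trans (dirMk_snd ..)
    rw [← actL _ _ h f g k e₁ e₃ e₄ hfg hgk]
    exact ((act_congr_hom H).trans (actR _ _ _ f g k e₁ e₃ e₄ hfg _)).symm
  · rintro ⟨H₀, H⟩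
    refine hom_tri_ext₂ (fun x => (projL x).trans (projR x).symm) (fun x y hy hy' => ?_)
      (fun x y hy hy' z hz hz' => ?_) (fun x d h h' => ?_)
    · rw [evL, evR, hδ]
    · have hyz : tgt hδ y = z ≫ c.map := by rw [hz', evR]
      rw [evR₂ x y hy' z hz' hyz, H₀]
      exact (evalAt_left (evL ..)).trans (evalAt_eq_tgt ..)
    · have h₁ : (d ≫ triSnd c (tri c c)) ≫ triMap c c = δ.app (tgt hδ (d ≫ triFst c (tri c c))) :=
        (snd_map h).trans (evL ..)
      have hfg := (fst_map_eq hδ h₁).symm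
      have hgk := tgt_fst hδ h₁
      rw [actL x d h _ _ _ rfl rfl rfl hfg hgk,
        actR x d h' _ _ _ rfl rfl rfl hfg ((H₀ _ _ _).trans hgk), H]

/-! ### The structure morphisms `t`, `i`, `k` and the recovery of `δ` from them -/

/-- Naturality at the universal direction `𝟙 c.dir`: the operation `tgt` is represented by one
morphism, the target map `t`. -/
theorem comp_tgt_id (f : X ⟶ c.dir) : f ≫ tgt hδ (𝟙 c.dir) = tgt hδ f := by
  rw [comp_tgt, Category.comp_id]

theorem comp_idn_id (ε : c ⟶ unit E) (x : X ⟶ c.pos) : x ≫ idn ε (𝟙 c.pos) = idn ε x := by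
  rw [comp_idn, Category.comp_id]

/-- The composition map determined by `δ : c ⟶ c ◁ c`. -/
noncomputable def mulMap : pullback (tgt hδ (𝟙 c.dir)) c.map ⟶ c.dir :=
  mul hδ (pullback.fst _ _) (pullback.snd _ _) ((comp_tgt_id ..).symm.trans pullback.condition)

theorem lift_mulMap (f g : X ⟶ c.dir) (h : f ≫ tgt hδ (𝟙 c.dir) = g ≫ c.map) :
    pullback.lift f g h ≫ mulMap hδ = mul hδ f g (by rw [← comp_tgt_id, h]) := by
  rw [mulMap, comp_mul]
  exact mul_congr hδ (pullback.lift_fst ..) (pullback.lift_snd ..)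

/-- Both positions lie over the identity and have value `t f` at every direction `f`, and a position
of `c ◁ c` is determined by its base and its values. -/
theorem pos_eq_posMk (δ : c ⟶ tri c c) (hδ : PreservesPos δ) :
    Hom.pos δ = posMk (p := c) (q := c) (𝟙 c.pos)
      (pullback.snd (𝟙 c.pos) c.map ≫ tgt hδ (𝟙 c.dir)) := by
  refine pos_ext ?_ fun w y h h' => ?_
  · rw [posMk_proj]
    exact (congrArg (· ≫ triProj c c) (Category.id_comp _).symm).trans (hδ _ _)
  · rw [evalAt_comp_posMk, pullback.lift_snd_assoc, comp_tgt_id]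
    exact evalAt_eq_tgt hδ (x := w) h

theorem snd_pos_map (δ : c ⟶ tri c c) :
    pullback.snd (Hom.pos δ) (triMap c c) ≫ triMap c c =
      δ.app (pullback.fst (Hom.pos δ) (triMap c c)) :=
  pullback.condition.symm

/-- The morphism `δ♯` is the action of `δ` on the universal pair of a position and a direction over
its image, and every such action is a composite by `act_eq_mul`. -/
theorem dir_eq_lift_mulMap (δ : c ⟶ tri c c) (hδ : PreservesPos δ)
    (h : (pullback.snd (Hom.pos δ) (triMap c c) ≫ triFst c c) ≫ tgt hδ (𝟙 c.dir) =
      (pullback.snd (Hom.pos δ) (triMap c c) ≫ triSnd c c) ≫ c.map) :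
    Hom.dir δ = pullback.lift (pullback.snd (Hom.pos δ) (triMap c c) ≫ triFst c c)
      (pullback.snd (Hom.pos δ) (triMap c c) ≫ triSnd c c) h ≫ mulMap hδ := by
  rw [lift_mulMap, ← act_eq_mul hδ (snd_pos_map δ)]
  have e : pullback.lift (pullback.fst (Hom.pos δ) (triMap c c))
      (pullback.snd (Hom.pos δ) (triMap c c)) pullback.condition = 𝟙 _ := by
    apply pullback.hom_ext <;> simp
  exact (Category.id_comp _).symm.trans (congrArg (· ≫ Hom.dir δ) e.symm)

/-- A morphism `c ⟶ c ◁ c` over the positions of `c` is determined by targets and composites. -/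
theorem comul_ext {δ' : c ⟶ tri c c} (hδ' : PreservesPos δ')
    (h : ∀ {X : E} (f : X ⟶ c.dir), tgt hδ f = tgt hδ' f)
    (h' : ∀ {X : E} (f g : X ⟶ c.dir) (hf : tgt hδ f = g ≫ c.map) (hf' : tgt hδ' f = g ≫ c.map),
      mul hδ f g hf = mul hδ' f g hf') : δ = δ' :=
  hom_tri_ext (fun x => (hδ _ x).trans (hδ' _ x).symm)
    (fun x y hy hy' => by rw [evalAt_eq_tgt hδ, evalAt_eq_tgt hδ', h])
    (fun x d hd hd' => by rw [act_eq_mul hδ, act_eq_mul hδ', h'])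

theorem counit_ext {ε ε' : c ⟶ unit E} (h : ∀ {X : E} (x : X ⟶ c.pos), idn ε x = idn ε' x) :
    ε = ε' :=
  hom_ext (fun _ => terminal.hom_ext ..) (fun x d _ _ => by rw [act_unit, act_unit, h])

/-- The internal category given by the underlying morphisms of a comonoid. -/
noncomputable def internalCategoryOfComon (ε : c ⟶ unit E) (δ : c ⟶ tri c c)
    (hl : δ ≫ triHom ε (𝟙 c) ≫ leftUnitorHom c = 𝟙 c)
    (hr : δ ≫ triHom (𝟙 c) ε ≫ rightUnitorHom c = 𝟙 c)
    (ha : δ ≫ triHom (𝟙 c) δ = δ ≫ triHom δ (𝟙 c) ≫ associatorHom c c c) :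
    InternalCategory c.map :=
  -- Needed before anything else, since targets and composites are defined only for a `δ` that keeps
  -- the underlying position.
  have hδ := preservesPos_of_comul_counit hr
  have H := (counit_comul_iff hδ ε).1 hl
  have A := (coassoc_iff hδ).1 ha
  have ht : mulMap hδ ≫ tgt hδ (𝟙 c.dir) =
      pullback.snd (tgt hδ (𝟙 c.dir)) c.map ≫ tgt hδ (𝟙 c.dir) := by
    rw [comp_tgt_id, comp_tgt_id, mulMap, A.1]
  { t := tgt hδ (𝟙 c.dir)
    i := idn ε (𝟙 c.pos)
    k := mulMap hδ
    i_s := idn_map ..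
    i_t := by rw [comp_tgt_id, H.1]
    k_s := mul_map ..
    k_t := ht
    -- Both unit laws are the elementwise ones at the universal direction `𝟙 c.dir`.
    id_comp := by
      rw [lift_mulMap]
      refine (mul_congr hδ ((comp_idn_id ..).trans ?_) rfl).trans (H.2 (𝟙 c.dir))
      rw [Category.id_comp]
    comp_id := by
      rw [lift_mulMap]
      exact (mul_congr hδ rfl (comp_idn_id ..)).trans ((comul_counit_iff hδ ε).1 hr (𝟙 c.dir))
    assoc := by
      rw [lift_mulMap, lift_mulMap]
      -- Associativity is the elementwise law at the universal composable triple, given by the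
      -- projections of the iterated pullback; this equation and the next one are its composability
      -- conditions.
      have hfg : tgt hδ (pullback.fst (pullback.snd (tgt hδ (𝟙 c.dir)) c.map ≫
            tgt hδ (𝟙 c.dir)) c.map ≫ pullback.fst (tgt hδ (𝟙 c.dir)) c.map) =
          (pullback.fst (pullback.snd (tgt hδ (𝟙 c.dir)) c.map ≫
            tgt hδ (𝟙 c.dir)) c.map ≫ pullback.snd (tgt hδ (𝟙 c.dir)) c.map) ≫ c.map := by
        refine (comp_tgt_id ..).symm.trans ?_
        rw [Category.assoc, pullback.condition, Category.assoc]
      have hgk : tgt hδ (pullback.fst (pullback.snd (tgt hδ (𝟙 c.dir)) c.map ≫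
            tgt hδ (𝟙 c.dir)) c.map ≫ pullback.snd (tgt hδ (𝟙 c.dir)) c.map) =
          pullback.snd (pullback.snd (tgt hδ (𝟙 c.dir)) c.map ≫ tgt hδ (𝟙 c.dir)) c.map ≫
            c.map := by
        refine (comp_tgt_id ..).symm.trans ?_
        rw [Category.assoc, pullback.condition]
      refine (mul_congr hδ (comp_mul ..) rfl).trans ((A.2 _ _ _ hfg hgk).trans ?_)
      exact mul_congr hδ rfl (lift_mulMap ..).symm }

end

/-! ### The comonoid of an internal category -/

section

variable (K : InternalCategory c.map)

/-- The counit of the comonoid of an internal category. -/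
noncomputable def counitOf : c ⟶ unit E where
  pos := terminal.from _
  dir := pullback.fst _ _ ≫ K.i
  w := by rw [Category.assoc, K.i_s, Category.comp_id]

theorem idn_counit (x : X ⟶ c.pos) : idn (counitOf K) x = x ≫ K.i :=
  pullback.lift_fst_assoc ..

/-- The action on positions of the comultiplication of an internal category. -/
noncomputable def comulPosOf : c.pos ⟶ triPos c c :=
  posMk (𝟙 c.pos) (pullback.snd (𝟙 c.pos) c.map ≫ K.t)

theorem comp_comulPos_proj (x : X ⟶ c.pos) :
    (x ≫ comulPosOf K) ≫ triProj c c = x := by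
  rw [Category.assoc, comulPosOf, posMk_proj, Category.comp_id]

/-- By construction the rule attached to `x` sends a direction to its target in `K`. -/
theorem evalAt_comp_comulPos (x : X ⟶ c.pos) (f : X ⟶ c.dir)
    (h : f ≫ c.map = (x ≫ comulPosOf K) ≫ triProj c c) :
    evalAt (x ≫ comulPosOf K) f h = f ≫ K.t :=
  (evalAt_comp_posMk ..).trans (pullback.lift_snd_assoc ..)

/-- Directions of `c ◁ c` over the image of `x` have composable components, so `K.k` applies to
them; this is what allows `comulOf` to be defined. -/
theorem fst_comp_t {x : X ⟶ c.pos} {d : X ⟶ triDir c c}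
    (h : d ≫ triMap c c = x ≫ comulPosOf K) :
    (d ≫ triFst c c) ≫ K.t = (d ≫ triSnd c c) ≫ c.map :=
  ((snd_map h).trans (evalAt_comp_comulPos ..)).symm

/-- The comultiplication of the comonoid of an internal category. -/
noncomputable def comulOf : c ⟶ tri c c where
  pos := comulPosOf K
  dir := pullback.lift (pullback.snd _ _ ≫ triFst c c) (pullback.snd _ _ ≫ triSnd c c)
    (fst_comp_t K pullback.condition.symm) ≫ K.k
  w := by
    rw [Category.assoc, K.k_s, pullback.lift_fst_assoc]
    exact (fst_map pullback.condition.symm).trans (comp_comulPos_proj ..)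

theorem preservesPos_comul : PreservesPos (comulOf K) :=
  fun _ x => comp_comulPos_proj K x

theorem tgt_comul (f : X ⟶ c.dir) : tgt (preservesPos_comul K) f = f ≫ K.t :=
  evalAt_comp_comulPos ..

theorem lift_k_congr {f g f' g' : X ⟶ c.dir} (hf : f = f') (hg : g = g')
    {h : f ≫ K.t = g ≫ c.map} {h' : f' ≫ K.t = g' ≫ c.map} :
    pullback.lift f g h ≫ K.k = pullback.lift f' g' h' ≫ K.k := by
  subst hf hg
  rfl

/-- The laws of `K` are equations between morphisms out of universal objects. This lemma transports
them along `u` to arbitrary stages, leaving the components to be identified by separate equations.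
-/
theorem comp_lift_k (u : Y ⟶ X) {f g : X ⟶ c.dir} (h : f ≫ K.t = g ≫ c.map) {f' g' : Y ⟶ c.dir}
    (hf : u ≫ f = f') (hg : u ≫ g = g') :
    u ≫ pullback.lift f g h ≫ K.k =
      pullback.lift f' g' (by rw [← hf, ← hg, Category.assoc, h, Category.assoc]) ≫ K.k := by
  subst hf hg
  rw [← Category.assoc]
  congr 1
  apply pullback.hom_ext <;> simp [pullback.lift_fst, pullback.lift_snd]

theorem act_comul {x : X ⟶ c.pos} {d : X ⟶ triDir c c}
    (h : d ≫ triMap c c = (comulOf K).app x) :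
    (comulOf K).act x d h =
      pullback.lift (d ≫ triFst c c) (d ≫ triSnd c c) (fst_comp_t K h) ≫ K.k :=
  comp_lift_k K _ _ (pullback.lift_snd_assoc ..) (pullback.lift_snd_assoc ..)

/-- Together with `tgt_comul` and `idn_counit`, this shows that the operations extracted from
`counitOf K` and `comulOf K` are those of `K`. -/
theorem mul_comul (f g : X ⟶ c.dir) (h : tgt (preservesPos_comul K) f = g ≫ c.map) :
    mul (preservesPos_comul K) f g h =
      pullback.lift f g ((tgt_comul K f).symm.trans h) ≫ K.k :=
  (act_comul ..).trans (lift_k_congr K (dirMk_fst ..) (dirMk_snd ..))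

theorem internalCategory_comul_counit :
    comulOf K ≫ triHom (𝟙 c) (counitOf K) ≫ rightUnitorHom c =
      𝟙 c := by
  refine (comul_counit_iff (preservesPos_comul K) _).2 fun {X} f => (mul_comul ..).trans ?_
  -- The elementwise law at `f` is `K.comp_id` precomposed with `f`.
  refine (comp_lift_k K f (f := 𝟙 _) (g := K.t ≫ K.i) ?_ (Category.comp_id f) ?_).symm.trans ?_
  · rw [Category.assoc, K.i_s, Category.comp_id, Category.id_comp]
  · rw [idn_counit, tgt_comul, Category.assoc]
  · rw [K.comp_id, Category.comp_id]

theorem internalCategory_counit_comul :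
    comulOf K ≫ triHom (counitOf K) (𝟙 c) ≫ leftUnitorHom c =
      𝟙 c := by
  refine (counit_comul_iff (preservesPos_comul K) _).2 ⟨fun x => ?_, fun {X} f =>
    (mul_comul ..).trans ?_⟩
  · rw [tgt_comul, idn_counit, Category.assoc, K.i_t, Category.comp_id]
  refine (comp_lift_k K f (f := c.map ≫ K.i) (g := 𝟙 _) ?_ ?_ (Category.comp_id f)).symm.trans ?_
  · rw [Category.assoc, K.i_t, Category.comp_id, Category.id_comp]
  · rw [idn_counit, Category.assoc]
  · rw [K.id_comp, Category.comp_id]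

theorem internalCategory_coassoc :
    comulOf K ≫ triHom (𝟙 c) (comulOf K) =
      comulOf K ≫ triHom (comulOf K) (𝟙 c) ≫
        associatorHom c c c := by
  refine (coassoc_iff (preservesPos_comul K)).2 ⟨fun f g hfg => ?_, fun {X} f g k hfg hgk => ?_⟩
  · rw [tgt_comul, tgt_comul, mul_comul, Category.assoc, K.k_t, pullback.lift_snd_assoc]
  have hfg' : f ≫ K.t = g ≫ c.map := (tgt_comul K f).symm.trans hfg
  have hgk' : g ≫ K.t = k ≫ c.map := (tgt_comul K g).symm.trans hgk
  -- The morphism classifying the triple `(f, g, k)`; precomposing `K.assoc` with it gives the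
  -- elementwise associativity law.
  let u : X ⟶ pullback (pullback.snd K.t c.map ≫ K.t) c.map :=
    pullback.lift (pullback.lift f g hfg') k (by rw [pullback.lift_snd_assoc, hgk'])
  have hu : u ≫ pullback.fst _ _ = pullback.lift f g hfg' := pullback.lift_fst ..
  have hu' : u ≫ pullback.snd _ _ = k := pullback.lift_snd ..
  have e := congrArg (u ≫ ·) K.assoc
  refine ((mul_comul ..).trans ?_).trans (e.trans ((mul_comul ..).trans ?_).symm)
  · refine (comp_lift_k K u _ ?_ hu').symm
    rw [← Category.assoc, hu, mul_comul]
  · refine (comp_lift_k K u _ ?_ ?_).symm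
    · rw [← Category.assoc, hu, pullback.lift_fst]
    · rw [mul_comul]
      refine comp_lift_k K u _ ?_ hu'
      rw [← Category.assoc, hu, pullback.lift_snd]

end

/-! ### The bijection -/

theorem comonObj_ext {S T : ComonObj c} (h : S.counit = T.counit) (h' : S.comul = T.comul) :
    S = T := by
  cases S
  cases T
  cases h
  cases h'
  rfl

/-- `ComonObj` states the counit laws with the inverse unitor on the right-hand side. Moving the
unitor across gives an equation of endomorphisms of `c`, the form analysed above. -/
theorem counit_comul_unitor (S : ComonObj c) :
    S.comul ≫ triHom S.counit (𝟙 c) ≫ leftUnitorHom c = 𝟙 c :=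
  (Category.assoc ..).symm.trans ((leftUnitor c).comp_hom_eq_id.2 (S.counit_comul))

theorem comul_counit_unitor (S : ComonObj c) :
    S.comul ≫ triHom (𝟙 c) S.counit ≫ rightUnitorHom c = 𝟙 c :=
  (Category.assoc ..).symm.trans ((rightUnitor c).comp_hom_eq_id.2 (S.comul_counit))

variable (c) in
/-- Comonoid structures on a polynomial `c` are the same as internal categories with source map
`c`. -/
noncomputable def comonEquiv : ComonObj c ≃ InternalCategory c.map where
  toFun S := internalCategoryOfComon S.counit S.comul (counit_comul_unitor S)
    (comul_counit_unitor S) S.comul_assoc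
  invFun K :=
    { counit := counitOf K
      comul := comulOf K
      counit_comul := (leftUnitor c).comp_hom_eq_id.1
        ((Category.assoc ..).trans (internalCategory_counit_comul K))
      comul_counit := (rightUnitor c).comp_hom_eq_id.1
        ((Category.assoc ..).trans (internalCategory_comul_counit K))
      comul_assoc := internalCategory_coassoc K }
  -- The rebuilt counit has the identities of `S`, and the rebuilt comultiplication its targets and
  -- composites; these determine both morphisms.
  left_inv S := comonObj_ext
    (counit_ext fun x => (idn_counit _ x).trans (comp_idn_id S.counit x))
    (comul_ext (preservesPos_comul _) (preservesPos_of_comul_counit (comul_counit_unitor S))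
      (fun f => (tgt_comul _ f).trans (comp_tgt_id _ f))
      (fun f g _ _ => (mul_comul _ f g _).trans (lift_mulMap _ f g _)))
  -- Targets and identities are compared at the universal elements, composites on every composable
  -- pair.
  right_inv K := InternalCategory.ext_of
    ((tgt_comul K (𝟙 c.dir)).trans (Category.id_comp _))
    ((idn_counit K (𝟙 c.pos)).trans (Category.id_comp _))
    (fun f g h _ => (lift_mulMap _ f g h).trans (mul_comul ..))

end Poly

end PolyIn

/-- The pullback of `c` along the identity of `C` is `C_*` through its second projection, so the
`posMk` clause says that `δ₁` is the transpose of `(t, id)`. The equation `h` says that the two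
projections to `C_*` land in the pullback on which `k` is defined. -/
theorem mainTheorem2 {E : Type u} [Category.{v} E] [HasFiniteLimits E] (c : PolyIn.Poly E) :
    ∃ e : ComonObj c ≃ PolyIn.InternalCategory c.map, ∀ S : ComonObj c,
      (e S).i = PolyIn.Poly.Hom.act S.counit (𝟙 c.pos) (terminal.from c.pos)
        (terminal.hom_ext _ _) ∧
      PolyIn.Poly.Hom.pos S.comul =
        PolyIn.Poly.posMk (p := c) (q := c) (𝟙 c.pos)
          (pullback.snd (𝟙 c.pos) c.map ≫ (e S).t) ∧
      ∃ h : (pullback.snd (PolyIn.Poly.Hom.pos S.comul) (PolyIn.Poly.triMap c c) ≫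
            PolyIn.Poly.triFst c c) ≫ (e S).t =
          (pullback.snd (PolyIn.Poly.Hom.pos S.comul) (PolyIn.Poly.triMap c c) ≫
            PolyIn.Poly.triSnd c c) ≫ c.map,
        PolyIn.Poly.Hom.dir S.comul =
          pullback.lift
            (pullback.snd (PolyIn.Poly.Hom.pos S.comul) (PolyIn.Poly.triMap c c) ≫
              PolyIn.Poly.triFst c c)
            (pullback.snd (PolyIn.Poly.Hom.pos S.comul) (PolyIn.Poly.triMap c c) ≫
              PolyIn.Poly.triSnd c c) h ≫ (e S).k := by
  refine ⟨PolyIn.Poly.comonEquiv c, fun S => ?_⟩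
  have hδ := PolyIn.Poly.preservesPos_of_comul_counit (PolyIn.Poly.comul_counit_unitor S)
  -- The identity map was defined as `ε♯` at the universal position, hence `rfl`.
  exact ⟨rfl, PolyIn.Poly.pos_eq_posMk S.comul hδ,
    (PolyIn.Poly.comp_tgt_id hδ _).trans (PolyIn.Poly.tgt_fst hδ (PolyIn.Poly.snd_pos_map S.comul)),
    PolyIn.Poly.dir_eq_lift_mulMap S.comul hδ _⟩
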